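/- Setting. Let $A\in\mathbb R^{m\times n}$ have full column rank, $b\in\mathbb R^n$, $c\in\mathbb R^m$, and for $i\in[m]$ let $l_i<u_i$ with $l_i\in\mathbb R\cup\{-\infty\}$, $u_i\in\mathbb R\cup\{+\infty\}$, not both infinite. Put $\Omega^0=\{x\in\mathbb R^m: A^Tx=b,\ l_i<x_i<u_i\ \forall i\}$. For each $i$ let $\phi_i$ be a 1-self-concordant barrier on $(l_i,u_i)$: thrice differentiable, $\phi_i''\ge 0$, $|\phi_i'''|\le 2(\phi_i'')^{3/2}$, $|\phi_i'|\le(\phi_i'')^{1/2}$, and $\phi_i\to+\infty$ at each finite end point. Operations on vectors (products, quotients, roots, $\log$, $\exp$) are coordinatewise, and $\phi'(x),\phi''(x)$ denote the vectors with entries $\phi_i'(x_i),\phi_i''(x_i)$. Let $\Phi''(x)=\mathrm{diag}(\phi''(x))$ and $W=\mathrm{diag}(w)$ for $w\in\mathbb R^m_{>0}$. For a constant $C_{\mathrm{norm}}$ let $\|y\|_{w+\infty}=\|y\|_\infty+C_{\mathrm{norm}}\big(\sum_i w_iy_i^2\big)^{1/2}$, with the induced operator norm for $m\times m$ matrices.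 Let $A_x=\Phi''(x)^{-1/2}A$, $P_{x,w}=I-W^{-1}A_x(A_x^TW^{-1}A_x)^{-1}A_x^T$, and $$h_t(x,w)=-\frac1{\sqrt{\phi''(x)}}\,P_{x,w}\!\left(\frac{tc+w\phi'(x)}{w\sqrt{\phi''(x)}}\right),\qquad \delta_t(x,w)=\min_{\eta\in\mathbb R^n}\left\|\frac{tc+w\phi'(x)-A\eta}{w\sqrt{\phi''(x)}}\right\|_{w+\infty}.$$ A weight function with constants $c_1,c_\gamma,c_\delta$ is a differentiable $g:\Omega^0\to\mathbb R^m_{>0}$ with Jacobian matrix $G'(x)$, and $G(x)=\mathrm{diag}(g(x))$, such that for all $x\in\Omega^0$: $\|g(x)\|_1=c_1$; $1\le c_\gamma\le\frac54$ and $\|P_{x,w}\|_{w+\infty}\le c_\gamma$ for every $w$ with $\frac45g(x)\le w\le\frac54g(x)$; $c_\delta c_\gamma<1$ and $\|G(x)^{-1}G'(x)\Phi''(x)^{-1/2}\|_{g(x)+\infty}\le c_\delta\le1$; and $\|g(x)\|_\infty\le2$. Let $\Psi(x,w)=\log g(x)-\log w$ and $\Phi_\mu(v)=\sum_i(e^{\mu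 v_i}+e^{-\mu v_i})$. One step of centeringInexact. Let $c_k=\frac1{1-c_\delta c_\gamma}$. From $(x,w)$ with parameters $t\geq 0$ and $K>0$, put $R=\frac{K}{48c_k\log(400m)}$, $\epsilon=\frac1{2c_k}$, $x^{(\mathrm{new})}=x+h_t(x,w)$ and $U=\{y\in\mathbb R^m:\|y\|_{w+\infty}\le(1-\frac7{8c_k})\delta_t(x,w)\}$. Take any $z$ with $\|z-\log g(x^{(\mathrm{new})})\|_\infty\le R$, any minimizer $d$ over $U$ of $\langle\nabla\Phi_{\epsilon/(12R)}(z-\log w),d\rangle$, and set $w^{(\mathrm{new})}=\exp(\log w-(1+\epsilon)d)$. Theorem. Let $g$ be a weight function with $5\le c_k\le24m^{1/4}$, let $1\le C_{\mathrm{norm}}\le2c_k$ and $0<K\le\frac1{20c_k}$, and let $\mu=2\log(400m)/K$ (which equals $\frac{\epsilon}{12R}$). Let $t\ge0$, $x\in\Omega^0$, $w\in\mathbb R^m_{>0}$ satisfy $$\delta:=\delta_t(x,w)\le\frac{K}{48c_k\log(400m)}\quad\text{and}\quad\Phi_\mu(\Psi(x,w))\le(400m)^2 .$$ Then every output $(x^{(\mathrm{new})},w^{(\mathrm{new})})$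 of one step of centeringInexact satisfies $x^{(\mathrm{new})}\in\Omega^0$, $w^{(\mathrm{new})}>0$, $$\delta_t(x^{(\mathrm{new})},w^{(\mathrm{new})})\le\Big(1-\frac1{4c_k}\Big)\delta,\qquad \Phi_\mu(\Psi(x^{(\mathrm{new})},w^{(\mathrm{new})}))\le(400m)^2,$$ $$\|\log g(x^{(\mathrm{new})})-\log w^{(\mathrm{new})}\|_\infty\le K\quad\text{and}\quad\|\log g(x^{(\mathrm{new})})-\log w\|_\infty\le K+\delta .$$ -/

import Mathlib

open Filter Topology

noncomputable section

namespace WeightedPath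

/-- The interior of the one-dimensional domain: the reals strictly between the two extended
real end points. -/
def openDom (l u : EReal) : Set ℝ := {s | l < (s : EReal) ∧ (s : EReal) < u}

/-- The linear program `min cᵀx` subject to `Aᵀx = b`, `lᵢ ≤ xᵢ ≤ uᵢ`, where `A` has full column
rank, `l i ∈ ℝ ∪ {-∞}`, `u i ∈ ℝ ∪ {+∞}`, and the domain of each coordinate is neither empty, nor a
singleton, nor the whole line. -/
structure LinProg (m n : ℕ) where
  A : Matrix (Fin m) (Fin n) ℝ
  b : Fin n → ℝ
  c : Fin m → ℝ
  l : Fin m → EReal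
  u : Fin m → EReal
  full_rank : A.rank = n
  l_lt_u : ∀ i, l i < u i
  not_line : ∀ i, l i ≠ ⊥ ∨ u i ≠ ⊤

/-- The interior `Ω⁰` of the polytope. -/
def LinProg.interior {m n : ℕ} (P : LinProg m n) : Set (Fin m → ℝ) :=
  {x | P.A.transpose.mulVec x = P.b ∧ ∀ i, x i ∈ openDom (P.l i) (P.u i)}

/-- `f` is a 1-self-concordant barrier function on the open interval with end points `l` and `u`:
it is thrice differentiable there, tends to `+∞` at each finite end point, and satisfies
`|f'''| ≤ 2 (f'')^{3/2}` and `|f'| ≤ (f'')^{1/2}`. Nonnegativity of `f''` makes the fractional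
powers meaningful. Values of `f` outside the interval are irrelevant. -/
structure IsSelfConcordantBarrier (l u : EReal) (f : ℝ → ℝ) : Prop where
  differentiable : ∀ s ∈ openDom l u, ∀ k < 3, DifferentiableAt ℝ (iteratedDeriv k f) s
  nonneg : ∀ s ∈ openDom l u, 0 ≤ iteratedDeriv 2 f s
  concordance : ∀ s ∈ openDom l u,
    |iteratedDeriv 3 f s| ≤ 2 * (iteratedDeriv 2 f s) ^ (3 / 2 : ℝ)
  force : ∀ s ∈ openDom l u, |deriv f s| ≤ √(iteratedDeriv 2 f s)
  tendsto_left : ∀ a : ℝ, (a : EReal) = l → Tendsto f (𝓝[>] a) atTop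
  tendsto_right : ∀ a : ℝ, (a : EReal) = u → Tendsto f (𝓝[<] a) atTop

/-- The coordinatewise square root `√φ''(x)`. -/
def sqrtHess {m : ℕ} (φ : Fin m → ℝ → ℝ) (x : Fin m → ℝ) : Fin m → ℝ :=
  fun i => √(iteratedDeriv 2 (φ i) (x i))

/-- The gradient in `x`, namely `t c + w φ'(x)`, of the penalized objective
`t cᵀx + ∑ wᵢ φᵢ(xᵢ)`. -/
def penalizedGrad {m : ℕ} (c : Fin m → ℝ) (φ : Fin m → ℝ → ℝ) (t : ℝ) (x w : Fin m → ℝ) :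
    Fin m → ℝ :=
  fun i => t * c i + w i * deriv (φ i) (x i)

/-- The mixed norm `‖y‖_{w+∞} = ‖y‖_∞ + C ‖y‖_W`, with `‖y‖_W = (∑ wᵢ yᵢ²)^{1/2}`. The first
summand is the norm of `Fin m → ℝ`, which is the supremum norm. -/
def mixedNorm {m : ℕ} (C : ℝ) (w y : Fin m → ℝ) : ℝ :=
  ‖y‖ + C * √(∑ i, w i * y i ^ 2)

/-- The operator norm of a matrix induced by the mixed norm. -/
def mixedOpNorm {m : ℕ} (C : ℝ) (w : Fin m → ℝ) (M : Matrix (Fin m) (Fin m) ℝ) : ℝ :=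
  sSup {r | ∃ y, mixedNorm C w y = 1 ∧ r = mixedNorm C w (M.mulVec y)}

/-- `P_{x,w} = I - W⁻¹ A_x (A_xᵀ W⁻¹ A_x)⁻¹ A_xᵀ` with `A_x = Φ''(x)^{-1/2} A`. -/
def projMatrix {m n : ℕ} (A : Matrix (Fin m) (Fin n) ℝ) (φ : Fin m → ℝ → ℝ)
    (x w : Fin m → ℝ) : Matrix (Fin m) (Fin m) ℝ :=
  let Ax : Matrix (Fin m) (Fin n) ℝ := Matrix.diagonal (fun i => (sqrtHess φ x i)⁻¹) * A
  let Winv : Matrix (Fin m) (Fin m) ℝ := Matrix.diagonal (fun i => (w i)⁻¹)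
  1 - Winv * Ax * (Ax.transpose * Winv * Ax)⁻¹ * Ax.transpose

/-- The projected Newton step `h_t(x,w)`. -/
def newtonStep {m n : ℕ} (P : LinProg m n) (φ : Fin m → ℝ → ℝ) (t : ℝ) (x w : Fin m → ℝ) :
    Fin m → ℝ :=
  fun i => -((sqrtHess φ x i)⁻¹ * (projMatrix P.A φ x w).mulVec
    (fun j => penalizedGrad P.c φ t x w j / (w j * sqrtHess φ x j)) i)

/-- The centrality `δ_t(x,w)`: the minimum over `η ∈ ℝⁿ` of
`‖(∇ₓ f_t(x,w) - A η) / (w √φ''(x))‖_{w+∞}`. -/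
def centrality {m n : ℕ} (P : LinProg m n) (φ : Fin m → ℝ → ℝ) (C t : ℝ) (x w : Fin m → ℝ) : ℝ :=
  ⨅ η : Fin n → ℝ, mixedNorm C w
    (fun i => (penalizedGrad P.c φ t x w i - P.A.mulVec η i) / (w i * sqrtHess φ x i))

/-- `g` is a weight function with size `c₁`, slack sensitivity `cγ` and step consistency `cδ`.
Only the values of `g` on `Ω⁰` matter; `J x` is a Jacobian matrix of `g` at `x`, where the
derivative is taken within `Ω⁰`. -/
structure IsWeightFunction {m n : ℕ} (P : LinProg m n) (φ : Fin m → ℝ → ℝ) (C : ℝ)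
    (g : (Fin m → ℝ) → (Fin m → ℝ)) (c₁ cγ cδ : ℝ) : Prop where
  pos : ∀ x ∈ P.interior, ∀ i, 0 < g x i
  size : ∀ x ∈ P.interior, ∑ i, |g x i| = c₁
  one_le_slack : 1 ≤ cγ
  slack_le : cγ ≤ 5 / 4
  slack : ∀ x ∈ P.interior, ∀ w : Fin m → ℝ,
    (∀ i, 4 / 5 * g x i ≤ w i ∧ w i ≤ 5 / 4 * g x i) →
      mixedOpNorm C w (projMatrix P.A φ x w) ≤ cγ
  step_mul_slack : cδ * cγ < 1
  step_le_one : cδ ≤ 1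
  step : ∃ J : (Fin m → ℝ) → Matrix (Fin m) (Fin m) ℝ, ∀ x ∈ P.interior,
    HasFDerivWithinAt g (LinearMap.toContinuousLinearMap (J x).mulVecLin) P.interior x ∧
    mixedOpNorm C (g x) (Matrix.diagonal (fun i => (g x i)⁻¹) * J x *
      Matrix.diagonal (fun i => (sqrtHess φ x i)⁻¹)) ≤ cδ
  uniformity : ∀ x ∈ P.interior, ‖g x‖ ≤ 2

/-- The coordinatewise logarithm. -/
def vecLog {m : ℕ} (v : Fin m → ℝ) : Fin m → ℝ := fun i => Real.log (v i)

/-- The potential `Φ_μ(v) = ∑ (e^{μ vᵢ} + e^{-μ vᵢ})`. -/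
def potential {m : ℕ} (μ : ℝ) (v : Fin m → ℝ) : ℝ :=
  ∑ i, (Real.exp (μ * v i) + Real.exp (-(μ * v i)))

/-- `Ψ(x,w) = log g(x) - log w`. -/
def logError {m : ℕ} (g : (Fin m → ℝ) → (Fin m → ℝ)) (x w : Fin m → ℝ) : Fin m → ℝ :=
  vecLog (g x) - vecLog w

/-- `(x', w')` is a possible output of one step of `centeringInexact` started at `(x, w)`.
With `R = K / (48 cₖ log(400 m))`, `ε = 1/(2cₖ)` and `δ = δ_t(x,w)`:

* `x'` is obtained from `x` by the projected Newton step;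
* `U` is the ball of radius `(1 - 7/(8cₖ)) δ` of the mixed norm at `w`;
* `z` is any vector with `‖z - log g(x')‖_∞ ≤ R`;
* `d` is any minimizer over `U` of `⟨∇Φ_{ε/(12R)}(z - log w), d⟩`, written as the derivative of the
  potential in the direction `d`;
* the new log-weights are such that the log-error `log g(x') - log w` moves by `(1+ε) d`. -/
def CenteringInexact {m n : ℕ} (P : LinProg m n) (φ : Fin m → ℝ → ℝ) (C : ℝ)
    (g : (Fin m → ℝ) → (Fin m → ℝ)) (ck t K : ℝ) (x w x' w' : Fin m → ℝ) : Prop :=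
  let R : ℝ := K / (48 * ck * Real.log (400 * m))
  let ε : ℝ := 1 / (2 * ck)
  let U : Set (Fin m → ℝ) :=
    {y | mixedNorm C w y ≤ (1 - 7 / (8 * ck)) * centrality P φ C t x w}
  x' = x + newtonStep P φ t x w ∧
  ∃ z d : Fin m → ℝ, ‖z - vecLog (g x')‖ ≤ R ∧ d ∈ U ∧
    IsMinOn (fun y => fderiv ℝ (potential (ε / (12 * R))) (z - vecLog w) y) U d ∧
    w' = fun i => Real.exp (Real.log (w i) - (1 + ε) * d i)

end WeightedPath

end

/-!
One step moves `x` by the projected Newton step `h` and the weights by `log w ↦ log w - (1+ε) d`.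
Write `δ` for the centrality at `(x, w)` and `k = 1 / c_k = 1 - c_δ c_γ`.

*Newton step.* The projection `P_{x,w}` kills the range of `W⁻¹ A_x`, so the operator norm bound
`c_γ` gives `‖√φ'' h‖ ≤ c_γ δ` in the mixed norm (`mixedNorm_newtonStep_le`). This is far below
one, so `x + h` stays in the domain: for a self-concordant barrier `1 / √φ''` is 1-Lipschitz, and a
barrier cannot blow up where `√φ'' ≥ |φ'|` is bounded (`IsSelfConcordantBarrier.add_mem`).

*Centrality.* The multiplier of the Newton step also serves at the new point. The residual consists
of the Taylor remainder of `φ'`, of size `O(δ²)`, and a term `≈ (1+ε) d` caused by the change of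
weights (`centrality_step_le`). As `(1 + k/2)(1 - 7k/8) ≤ 1 - 3k/8` and `δ` is tiny compared with
`k`, the factor `1 - k/4` results (`centrality_step_contract`).

*Weight function.* Along the segment from `x` to `x + h` the step consistency of `g` bounds the
derivative of `log g` by `c_δ ‖√φ'' h‖`, in the norm of the current weight `g`. A continuity
argument keeps this norm comparable to that of `w`, so that `log g` moves by at most `(1 + k/19)²
c_δ c_γ δ / (1 - 5δ/4) ≤ (1 - 7k/8) δ` (`mixedNorm_log_weight_sub_le`). Hence this movement `u`
belongs to the ball `U` over which the algorithm minimizes.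

*Potential.* The log-error changes by `u + (1+ε) d`, where `d ∈ U` minimizes the potential
linearized at an approximation of the current log-error. Since `-u ∈ U`, the linear terms sum to at
most `-ε` times the dual norm of the gradient, which beats the second-order terms whenever the
potential is above a threshold of order `m²`; below the threshold one step cannot bring it above
`(400 m)²` (`potential_le_max`, `potential_step_le`). The potential bound gives back
`‖log g - log w‖ ≤ K` by taking logarithms (`norm_le_of_potential_le`).
-/

noncomputable section

namespace WeightedPath

variable {m n : ℕ}

/-! ### The mixed norm -/

set_option synthInstance.maxHeartbeats 200000 in
/-- The linear embedding `y ↦ (y, C √w y)` into the `ℓ¹`-product of a sup-normed and a Euclidean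
space. Its norm is the mixed norm (`norm_mixedEmbedding`), which makes Mathlib's calculus for
normed spaces available for the mixed norm. -/
def mixedEmbedding (C : ℝ) (w : Fin m → ℝ) :
    (Fin m → ℝ) →L[ℝ] WithLp 1 ((Fin m → ℝ) × EuclideanSpace ℝ (Fin m)) :=
  LinearMap.toContinuousLinearMap
    { toFun := fun y => WithLp.toLp 1 (y, WithLp.toLp 2 (fun i => C * √(w i) * y i))
      map_add' := fun x y => by
        refine WithLp.ofLp_injective 1 (Prod.ext (by simp) ?_)
        ext i
        simp [mul_add]
      map_smul' := fun a y => by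
        refine WithLp.ofLp_injective 1 (Prod.ext (by simp) ?_)
        ext i
        simp [mul_left_comm] }

theorem norm_mixedEmbedding {C : ℝ} (hC : 0 ≤ C) {w : Fin m → ℝ} (hw : ∀ i, 0 ≤ w i)
    (y : Fin m → ℝ) : ‖mixedEmbedding C w y‖ = mixedNorm C w y := by
  have h : ‖WithLp.toLp 2 (fun i => C * √(w i) * y i)‖ = C * √(∑ i, w i * y i ^ 2) := by
    rw [EuclideanSpace.norm_eq]
    have : ∀ i, ‖C * √(w i) * y i‖ ^ 2 = C ^ 2 * (w i * y i ^ 2) := fun i => by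
      rw [Real.norm_eq_abs, sq_abs, mul_pow, mul_pow, Real.sq_sqrt (hw i)]; ring
    simp only [this]
    rw [← Finset.mul_sum, Real.sqrt_mul (sq_nonneg C), Real.sqrt_sq hC]
  rw [mixedNorm, ← h, mixedEmbedding]
  simp [WithLp.prod_norm_eq_of_L1]

section MixedNorm

variable {C : ℝ} {w : Fin m → ℝ}

theorem norm_le_mixedNorm (hC : 0 ≤ C) (w y : Fin m → ℝ) : ‖y‖ ≤ mixedNorm C w y :=
  le_add_of_nonneg_right (mul_nonneg hC (Real.sqrt_nonneg _))

theorem mixedNorm_nonneg (hC : 0 ≤ C) (w y : Fin m → ℝ) : 0 ≤ mixedNorm C w y :=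
  (norm_nonneg y).trans (norm_le_mixedNorm hC w y)

theorem mixedNorm_add_le (hC : 0 ≤ C) (hw : ∀ i, 0 ≤ w i) (y z : Fin m → ℝ) :
    mixedNorm C w (y + z) ≤ mixedNorm C w y + mixedNorm C w z := by
  simp only [← norm_mixedEmbedding hC hw, map_add]
  exact norm_add_le _ _

theorem mixedNorm_smul (hC : 0 ≤ C) (hw : ∀ i, 0 ≤ w i) (a : ℝ) (y : Fin m → ℝ) :
    mixedNorm C w (a • y) = |a| * mixedNorm C w y := by
  simp only [← norm_mixedEmbedding hC hw, map_smul, norm_smul, Real.norm_eq_abs]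

theorem mixedNorm_mono (hC : 0 ≤ C) (hw : ∀ i, 0 ≤ w i) {y z : Fin m → ℝ}
    (h : ∀ i, |y i| ≤ |z i|) : mixedNorm C w y ≤ mixedNorm C w z := by
  refine add_le_add ?_ (mul_le_mul_of_nonneg_left (Real.sqrt_le_sqrt ?_) hC)
  · exact (pi_norm_le_iff_of_nonneg (norm_nonneg z)).2 fun i => (h i).trans (norm_le_pi_norm z i)
  · exact Finset.sum_le_sum fun i _ => mul_le_mul_of_nonneg_left (sq_le_sq.2 (h i)) (hw i)

theorem mixedNorm_le_of_weight_le (hC : 0 ≤ C) {v : Fin m → ℝ} {a : ℝ} (ha : 1 ≤ a)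
    (h : ∀ i, v i ≤ a ^ 2 * w i) (y : Fin m → ℝ) :
    mixedNorm C v y ≤ a * mixedNorm C w y := by
  have h0 : (0 : ℝ) ≤ a := by linarith
  have h1 : √(∑ i, v i * y i ^ 2) ≤ a * √(∑ i, w i * y i ^ 2) := by
    nth_rewrite 1 [← Real.sqrt_sq h0]
    rw [← Real.sqrt_mul (sq_nonneg a), Finset.mul_sum]
    refine Real.sqrt_le_sqrt (Finset.sum_le_sum fun i _ => ?_)
    rw [← mul_assoc]
    exact mul_le_mul_of_nonneg_right (h i) (sq_nonneg _)
  have h2 : ‖y‖ ≤ a * ‖y‖ := le_mul_of_one_le_left (norm_nonneg y) ha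
  have h3 := mul_le_mul_of_nonneg_left h1 hC
  rw [mixedNorm, mixedNorm]
  linarith

theorem mixedNorm_le_mul_norm (hC : 0 ≤ C) (hw : ∀ i, 0 ≤ w i) (y : Fin m → ℝ) :
    mixedNorm C w y ≤ (1 + C * √(∑ i, w i)) * ‖y‖ := by
  have h1 : √(∑ i, w i * y i ^ 2) ≤ √(∑ i, w i) * ‖y‖ := by
    nth_rewrite 1 [← Real.sqrt_sq (norm_nonneg y)]
    rw [← Real.sqrt_mul (Finset.sum_nonneg fun i _ => hw i),
      Finset.sum_mul]
    refine Real.sqrt_le_sqrt (Finset.sum_le_sum fun i _ => ?_)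
    refine mul_le_mul_of_nonneg_left ?_ (hw i)
    rw [← sq_abs]
    exact pow_le_pow_left₀ (abs_nonneg _) (norm_le_pi_norm y i) 2
  have h3 := mul_le_mul_of_nonneg_left h1 hC
  rw [mixedNorm]
  linarith

/-- The supremum defining `mixedOpNorm` is over a bounded set, so it is a genuine operator norm. -/
theorem mixedNorm_mulVec_le (hC : 0 ≤ C) (hw : ∀ i, 0 ≤ w i) (M : Matrix (Fin m) (Fin m) ℝ)
    (y : Fin m → ℝ) :
    mixedNorm C w (M.mulVec y) ≤ mixedOpNorm C w M * mixedNorm C w y := by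
  have hbdd : BddAbove {r | ∃ y, mixedNorm C w y = 1 ∧ r = mixedNorm C w (M.mulVec y)} := by
    refine ⟨(1 + C * √(∑ i, w i)) * ‖LinearMap.toContinuousLinearMap M.mulVecLin‖, ?_⟩
    rintro r ⟨y, hy, rfl⟩
    refine (mixedNorm_le_mul_norm hC hw _).trans ?_
    have h1 := (LinearMap.toContinuousLinearMap M.mulVecLin).le_opNorm y
    have h2 : ‖y‖ ≤ 1 := hy ▸ norm_le_mixedNorm hC w y
    refine mul_le_mul_of_nonneg_left (h1.trans (mul_le_of_le_one_right (norm_nonneg _) h2)) ?_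
    positivity
  rcases (mixedNorm_nonneg hC w y).eq_or_lt with h0 | h0
  · have hy : y = 0 := norm_le_zero_iff.1 (h0 ▸ norm_le_mixedNorm hC w y)
    subst hy
    simp [mixedNorm]
  · set N := mixedNorm C w y with hN
    have hy : mixedNorm C w (N⁻¹ • y) = 1 := by
      rw [mixedNorm_smul hC hw, abs_of_pos (inv_pos.2 h0), ← hN, inv_mul_cancel₀ h0.ne']
    have h1 : mixedNorm C w (M.mulVec (N⁻¹ • y)) ≤ mixedOpNorm C w M :=
      le_csSup hbdd ⟨_, hy, rfl⟩
    rw [Matrix.mulVec_smul, mixedNorm_smul hC hw, abs_of_pos (inv_pos.2 h0),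
      inv_mul_le_iff₀ h0] at h1
    linarith

end MixedNorm

/-! ### Self-concordant barriers in one variable -/

theorem neg_mem_openDom {l u : EReal} {s : ℝ} : -s ∈ openDom l u ↔ s ∈ openDom (-u) (-l) := by
  simp only [openDom, Set.mem_ofPred_eq, EReal.coe_neg]
  rw [EReal.lt_neg_comm, EReal.neg_lt_comm, and_comm]

theorem ordConnected_openDom (l u : EReal) : (openDom l u).OrdConnected :=
  ⟨fun _ hx _ hy _ hz => ⟨hx.1.trans_le (EReal.coe_le_coe_iff.2 hz.1),
    (EReal.coe_le_coe_iff.2 hz.2).trans_lt hy.2⟩⟩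

namespace IsSelfConcordantBarrier

variable {l u : EReal} {f : ℝ → ℝ}

/-- Reflection exchanges the two end points, so one-sided statements suffice. -/
theorem comp_neg (hf : IsSelfConcordantBarrier l u f) :
    IsSelfConcordantBarrier (-u) (-l) (fun s => f (-s)) where
  differentiable s hs k hk := by
    have h := hf.differentiable (-s) (neg_mem_openDom.2 hs) k hk
    have h1 : iteratedDeriv k (fun s => f (-s)) =
        fun s => (-1 : ℝ) ^ k • iteratedDeriv k f (-s) :=
      funext fun a => iteratedDeriv_comp_neg k f a
    rw [h1]
    exact (h.comp s differentiableAt_id.neg).const_smul ((-1 : ℝ) ^ k)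
  nonneg s hs := by
    rw [iteratedDeriv_comp_neg]
    simpa using hf.nonneg (-s) (neg_mem_openDom.2 hs)
  concordance s hs := by
    rw [iteratedDeriv_comp_neg, iteratedDeriv_comp_neg, smul_eq_mul, abs_mul]
    simpa using hf.concordance (-s) (neg_mem_openDom.2 hs)
  force s hs := by
    rw [iteratedDeriv_comp_neg, deriv_comp_neg, abs_neg]
    simpa using hf.force (-s) (neg_mem_openDom.2 hs)
  tendsto_left a ha := by
    refine (hf.tendsto_right (-a) (by simp [ha])).comp ?_
    exact tendsto_neg_nhdsGT
  tendsto_right a ha := by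
    refine (hf.tendsto_left (-a) (by simp [ha])).comp ?_
    exact tendsto_neg_nhdsLT

theorem hasDerivAt (hf : IsSelfConcordantBarrier l u f) {s : ℝ} (hs : s ∈ openDom l u) :
    HasDerivAt f (deriv f s) s := by
  have h := hf.differentiable s hs 0 (by norm_num)
  rw [iteratedDeriv_zero] at h
  exact h.hasDerivAt

theorem hasDerivAt_deriv (hf : IsSelfConcordantBarrier l u f) {s : ℝ} (hs : s ∈ openDom l u) :
    HasDerivAt (deriv f) (iteratedDeriv 2 f s) s := by
  have h := (hf.differentiable s hs 1 (by norm_num)).hasDerivAt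
  rwa [← iteratedDeriv_succ, iteratedDeriv_one] at h

theorem hasDerivAt_hess (hf : IsSelfConcordantBarrier l u f) {s : ℝ} (hs : s ∈ openDom l u) :
    HasDerivAt (iteratedDeriv 2 f) (iteratedDeriv 3 f s) s := by
  have h := (hf.differentiable s hs 2 (by norm_num)).hasDerivAt
  rwa [← iteratedDeriv_succ] at h

theorem abs_third_le (hf : IsSelfConcordantBarrier l u f) {s : ℝ} (hs : s ∈ openDom l u) :
    |iteratedDeriv 3 f s| ≤ 2 * √(iteratedDeriv 2 f s) ^ 3 := by
  have h := hf.concordance s hs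
  rw [Real.rpow_div_two_eq_sqrt _ (hf.nonneg s hs)] at h
  exact_mod_cast h

/-- If `f''` vanished at a point, then by Grönwall's inequality it would vanish from there up to
the finite end point, and so would `f'` because `|f'| ≤ √f''`; a constant is not a barrier. -/
theorem hess_pos_of_right (hf : IsSelfConcordantBarrier l u f) {a : ℝ} (ha : (a : EReal) = u)
    {s : ℝ} (hs : s ∈ openDom l u) : 0 < iteratedDeriv 2 f s := by
  by_contra hneg
  have h0 : iteratedDeriv 2 f s = 0 := le_antisymm (not_lt.1 hneg) (hf.nonneg s hs)
  have hsa : s < a := EReal.coe_lt_coe_iff.1 (ha ▸ hs.2)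
  have hmem : ∀ y, s ≤ y → y < a → y ∈ openDom l u := fun y h1 h2 =>
    ⟨hs.1.trans_le (EReal.coe_le_coe_iff.2 h1), ha ▸ EReal.coe_lt_coe_iff.2 h2⟩
  have hzero : ∀ y, s ≤ y → y < a → iteratedDeriv 2 f y = 0 := by
    intro y h1 h2
    have hD : ∀ z ∈ Set.Icc s y, z ∈ openDom l u := fun z hz => hmem z hz.1 (hz.2.trans_lt h2)
    have hcont : ContinuousOn (iteratedDeriv 2 f) (Set.Icc s y) := fun z hz =>
      (hf.hasDerivAt_hess (hD z hz)).continuousAt.continuousWithinAt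
    obtain ⟨M, hM⟩ := isCompact_Icc.bddAbove_image hcont
    refine eq_zero_of_abs_deriv_le_mul_abs_self_of_eq_zero_right (f' := iteratedDeriv 3 f)
      (K := 2 * √M) hcont
      (fun z hz => (hf.hasDerivAt_hess (hD z ⟨hz.1, hz.2.le⟩)).hasDerivWithinAt) h0 ?_ y ⟨h1, le_rfl⟩
    intro z hz
    have hzD := hD z ⟨hz.1, hz.2.le⟩
    have h3 := hf.abs_third_le hzD
    have h4 := hf.nonneg z hzD
    have h5 : √(iteratedDeriv 2 f z) ≤ √M :=
      Real.sqrt_le_sqrt (hM ⟨z, ⟨hz.1, hz.2.le⟩, rfl⟩)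
    rw [Real.norm_eq_abs, Real.norm_eq_abs, abs_of_nonneg h4]
    refine h3.trans ?_
    have h6 := Real.sq_sqrt h4
    have h7 := mul_le_mul_of_nonneg_right h5 h4
    calc 2 * √(iteratedDeriv 2 f z) ^ 3
        = 2 * (√(iteratedDeriv 2 f z) * √(iteratedDeriv 2 f z) ^ 2) := by ring
      _ ≤ 2 * √M * iteratedDeriv 2 f z := by rw [h6]; linarith
  have hconst : ∀ y, s ≤ y → y < a → f y = f s := by
    intro y h1 h2
    have hD : ∀ z ∈ Set.Icc s y, z ∈ openDom l u := fun z hz => hmem z hz.1 (hz.2.trans_lt h2)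
    refine constant_of_has_deriv_right_zero
      (fun z hz => (hf.hasDerivAt (hD z hz)).continuousAt.continuousWithinAt) ?_ y ⟨h1, le_rfl⟩
    intro z hz
    have hzD := hD z ⟨hz.1, hz.2.le⟩
    have h3 := hf.force z hzD
    rw [hzero z hz.1 (hz.2.trans h2), Real.sqrt_zero] at h3
    have h4 : deriv f z = 0 := abs_nonpos_iff.1 h3
    exact h4 ▸ (hf.hasDerivAt hzD).hasDerivWithinAt
  obtain ⟨y, hy1, hy2⟩ := (((hf.tendsto_right a ha).eventually_gt_atTop (f s)).and
    (Ioo_mem_nhdsLT hsa)).exists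
  exact absurd (hconst y hy2.1.le hy2.2) hy1.ne'

theorem hess_pos (hf : IsSelfConcordantBarrier l u f) (hlu : l ≠ ⊥ ∨ u ≠ ⊤) {s : ℝ}
    (hs : s ∈ openDom l u) : 0 < iteratedDeriv 2 f s := by
  have hu0 : u ≠ ⊥ := (bot_le.trans_lt hs.2).ne'
  have hl0 : l ≠ ⊤ := (hs.1.trans_le le_top).ne
  rcases hlu with h | h
  · have ha : ((-l.toReal : ℝ) : EReal) = -l := by rw [EReal.coe_neg, EReal.coe_toReal hl0 h]
    have h1 := hf.comp_neg.hess_pos_of_right ha (s := -s) (by rwa [← neg_mem_openDom, neg_neg])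
    rw [iteratedDeriv_comp_neg] at h1
    simpa using h1
  · exact hf.hess_pos_of_right (EReal.coe_toReal h hu0) hs

/-- The reciprocal of `√f''` is 1-Lipschitz: its derivative is `-f''' / (2 (f'')^{3/2})`. -/
theorem abs_inv_sqrt_hess_sub_le (hf : IsSelfConcordantBarrier l u f) (hlu : l ≠ ⊥ ∨ u ≠ ⊤)
    {s y : ℝ} (hs : s ∈ openDom l u) (hy : y ∈ openDom l u) :
    |(√(iteratedDeriv 2 f y))⁻¹ - (√(iteratedDeriv 2 f s))⁻¹| ≤ |y - s| := by
  have h := (ordConnected_openDom l u).convex.norm_image_sub_le_of_norm_hasDerivWithin_le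
    (𝕜 := ℝ) (f := fun z => (√(iteratedDeriv 2 f z))⁻¹) (C := 1)
    (fun z hz => (((hf.hasDerivAt_hess hz).sqrt (hf.hess_pos hlu hz).ne').inv
      (Real.sqrt_pos.2 (hf.hess_pos hlu hz)).ne').hasDerivWithinAt) ?_ hs hy
  · simpa using h
  · intro z hz
    have hq := Real.sqrt_pos.2 (hf.hess_pos hlu hz)
    have h3 := hf.abs_third_le hz
    rw [norm_div, norm_neg, norm_div, Real.norm_eq_abs, Real.norm_of_nonneg (by positivity),
      Real.norm_of_nonneg (by positivity), div_div, div_le_one (by positivity)]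
    linarith [pow_succ (√(iteratedDeriv 2 f z)) 2]

/-- A step upwards of local length less than one stays below the end point: along it `√f''`, hence
`|f'|`, stays bounded, so `f` cannot blow up. -/
theorem add_lt (hf : IsSelfConcordantBarrier l u f) (hlu : l ≠ ⊥ ∨ u ≠ ⊤)
    {s h : ℝ} (hs : s ∈ openDom l u) (hr : √(iteratedDeriv 2 f s) * h < 1) :
    ((s + h : ℝ) : EReal) < u := by
  rcases eq_or_ne u ⊤ with htop | htop
  · rw [htop]; exact EReal.coe_lt_top _
  obtain ⟨a, ha⟩ : ∃ a : ℝ, (a : EReal) = u :=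
    ⟨u.toReal, EReal.coe_toReal htop (bot_le.trans_lt hs.2).ne'⟩
  by_contra hcon
  have hle : a ≤ s + h := by
    rw [← ha, EReal.coe_lt_coe_iff] at hcon
    exact not_lt.1 hcon
  have hsa : s < a := EReal.coe_lt_coe_iff.1 (ha ▸ hs.2)
  have hmem : ∀ y, s ≤ y → y < a → y ∈ openDom l u := fun y h1 h2 =>
    ⟨hs.1.trans_le (EReal.coe_le_coe_iff.2 h1), ha ▸ EReal.coe_lt_coe_iff.2 h2⟩
  have hq := Real.sqrt_pos.2 (hf.hess_pos hlu hs)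
  set κ := (√(iteratedDeriv 2 f s))⁻¹ - h with hκ
  have hκpos : 0 < κ := by
    rw [hκ, sub_pos, ← one_div, lt_div_iff₀ hq]; linarith
  have hbound : ∀ y, s ≤ y → y < a → f y ≤ f s + κ⁻¹ * h := by
    intro y h1 h2
    have hD : ∀ z ∈ Set.Icc s y, z ∈ openDom l u := fun z hz => hmem z hz.1 (hz.2.trans_lt h2)
    have hmv := (convex_Icc s y).norm_image_sub_le_of_norm_hasDerivWithin_le (𝕜 := ℝ) (f := f)
      (f' := deriv f) (C := κ⁻¹) (fun z hz => (hf.hasDerivAt (hD z hz)).hasDerivWithinAt) ?_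
      (Set.left_mem_Icc.2 h1) (Set.right_mem_Icc.2 h1)
    · rw [Real.norm_eq_abs, Real.norm_eq_abs, abs_of_nonneg (sub_nonneg.2 h1)] at hmv
      have h3 : κ⁻¹ * (y - s) ≤ κ⁻¹ * h :=
        mul_le_mul_of_nonneg_left (by linarith) (inv_pos.2 hκpos).le
      linarith [le_abs_self (f y - f s)]
    · intro z hz
      have hzq := Real.sqrt_pos.2 (hf.hess_pos hlu (hD z hz))
      have h3 := hf.abs_inv_sqrt_hess_sub_le hlu hs (hD z hz)
      rw [abs_of_nonneg (sub_nonneg.2 hz.1)] at h3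
      have h4 : κ ≤ (√(iteratedDeriv 2 f z))⁻¹ := by
        linarith [(abs_le.1 h3).1, hz.2]
      exact (hf.force z (hD z hz)).trans ((le_inv_comm₀ hκpos hzq).1 h4)
  obtain ⟨y, hy1, hy2⟩ := (((hf.tendsto_right a ha).eventually_gt_atTop (f s + κ⁻¹ * h)).and
    (Ioo_mem_nhdsLT hsa)).exists
  exact absurd (hbound y hy2.1.le hy2.2) (not_le.2 hy1)

/-- The Dikin interval around `s` lies in the domain. -/
theorem add_mem (hf : IsSelfConcordantBarrier l u f) (hlu : l ≠ ⊥ ∨ u ≠ ⊤)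
    {s h : ℝ} (hs : s ∈ openDom l u) (hr : √(iteratedDeriv 2 f s) * |h| < 1) :
    s + h ∈ openDom l u := by
  rcases le_total 0 h with hh | hh
  · rw [abs_of_nonneg hh] at hr
    exact ⟨hs.1.trans_le (EReal.coe_le_coe_iff.2 (by linarith)), hf.add_lt hlu hs hr⟩
  · rw [abs_of_nonpos hh] at hr
    have h1 := hf.comp_neg.add_lt (hlu.symm.imp (by simp) (by simp)) (s := -s) (h := -h)
      (by rwa [← neg_mem_openDom, neg_neg])
      (by rw [iteratedDeriv_comp_neg]; simpa using hr)
    refine ⟨?_, (EReal.coe_le_coe_iff.2 (by linarith)).trans_lt hs.2⟩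
    rw [← neg_add, EReal.coe_neg] at h1
    exact EReal.neg_lt_neg_iff.1 h1

/-- Local norms at points of the Dikin interval are comparable. -/
theorem sqrt_hess_add_bounds (hf : IsSelfConcordantBarrier l u f) (hlu : l ≠ ⊥ ∨ u ≠ ⊤)
    {s h r : ℝ} (hs : s ∈ openDom l u) (hr : √(iteratedDeriv 2 f s) * |h| ≤ r) (hr1 : r < 1) :
    (1 - r) * √(iteratedDeriv 2 f (s + h)) ≤ √(iteratedDeriv 2 f s) ∧
      √(iteratedDeriv 2 f s) ≤ (1 + r) * √(iteratedDeriv 2 f (s + h)) := by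
  have hy := hf.add_mem hlu hs (hr.trans_lt hr1)
  have hq := Real.sqrt_pos.2 (hf.hess_pos hlu hs)
  have hq' := Real.sqrt_pos.2 (hf.hess_pos hlu hy)
  have h1 := hf.abs_inv_sqrt_hess_sub_le hlu hs hy
  rw [add_sub_cancel_left] at h1
  set q := √(iteratedDeriv 2 f s)
  set q' := √(iteratedDeriv 2 f (s + h))
  have h2 : |q - q'| ≤ r * q' := by
    have h3 : q - q' = q * q' * (q'⁻¹ - q⁻¹) := by field_simp
    rw [h3, abs_mul, abs_of_pos (mul_pos hq hq')]
    calc q * q' * |q'⁻¹ - q⁻¹| ≤ q * q' * |h| := by gcongr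
      _ = q * |h| * q' := by ring
      _ ≤ r * q' := by gcongr
  have := abs_le.1 h2
  constructor <;> linarith

/-- A Taylor estimate for `f'`, in the local norm. -/
theorem abs_deriv_add_sub_le (hf : IsSelfConcordantBarrier l u f) (hlu : l ≠ ⊥ ∨ u ≠ ⊤)
    {s h r : ℝ} (hs : s ∈ openDom l u) (hr : √(iteratedDeriv 2 f s) * |h| ≤ r) (hr1 : r < 1) :
    |deriv f (s + h) - deriv f s - iteratedDeriv 2 f s * h| ≤
      2 * (√(iteratedDeriv 2 f s) / (1 - r)) ^ 3 * |h| ^ 2 := by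
  have hq := Real.sqrt_pos.2 (hf.hess_pos hlu hs)
  set q := √(iteratedDeriv 2 f s) with hqdef
  set B := 2 * (q / (1 - r)) ^ 3 with hB
  have h1r : 0 < 1 - r := by linarith
  have hB0 : 0 ≤ B := by positivity
  have hloc : ∀ z ∈ Set.uIcc s (s + h), |z - s| ≤ |h| := fun z hz => by
    simpa [abs_sub_comm] using Set.abs_sub_left_of_mem_uIcc hz
  have hmem : ∀ z ∈ Set.uIcc s (s + h), z ∈ openDom l u ∧ √(iteratedDeriv 2 f z) ≤ q / (1 - r) := by
    intro z hz
    have h1 : q * |z - s| ≤ r := (mul_le_mul_of_nonneg_left (hloc z hz) hq.le).trans hr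
    have h2 := hf.add_mem hlu hs (h1.trans_lt hr1)
    have h3 := (hf.sqrt_hess_add_bounds hlu hs h1 hr1).1
    rw [add_sub_cancel] at h2 h3
    exact ⟨h2, by rw [le_div_iff₀ h1r]; linarith⟩
  have hhess : ∀ z ∈ Set.uIcc s (s + h), |iteratedDeriv 2 f z - iteratedDeriv 2 f s| ≤ B * |h| := by
    intro z hz
    have hmv := (convex_uIcc s (s + h)).norm_image_sub_le_of_norm_hasDerivWithin_le (𝕜 := ℝ)
      (f := iteratedDeriv 2 f) (f' := iteratedDeriv 3 f) (C := B)
      (fun z hz => (hf.hasDerivAt_hess (hmem z hz).1).hasDerivWithinAt) ?_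
      Set.left_mem_uIcc hz
    · exact hmv.trans (mul_le_mul_of_nonneg_left (hloc z hz) hB0)
    · intro z hz
      refine (hf.abs_third_le (hmem z hz).1).trans ?_
      have := (hmem z hz).2
      rw [hB]
      gcongr
  have hmv := (convex_uIcc s (s + h)).norm_image_sub_le_of_norm_hasDerivWithin_le (𝕜 := ℝ)
    (f := fun z => deriv f z - iteratedDeriv 2 f s * z)
    (f' := fun z => iteratedDeriv 2 f z - iteratedDeriv 2 f s * 1) (C := B * |h|)
    (fun z hz => ((hf.hasDerivAt_deriv (hmem z hz).1).sub
      ((hasDerivAt_id z).const_mul (iteratedDeriv 2 f s))).hasDerivWithinAt)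
    (fun z hz => by simpa using hhess z hz) Set.left_mem_uIcc Set.right_mem_uIcc
  rw [Real.norm_eq_abs, Real.norm_eq_abs, add_sub_cancel_left] at hmv
  calc |deriv f (s + h) - deriv f s - iteratedDeriv 2 f s * h|
      = |deriv f (s + h) - iteratedDeriv 2 f s * (s + h) -
          (deriv f s - iteratedDeriv 2 f s * s)| := by congr 1; ring
    _ ≤ B * |h| * |h| := hmv
    _ = B * |h| ^ 2 := by ring

end IsSelfConcordantBarrier

/-! ### The projected Newton step -/

section Newton

open Matrix

theorem LinProg.mulVec_injective (P : LinProg m n) : Function.Injective P.A.mulVec := by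
  have h1 := P.A.mulVecLin.finrank_range_add_finrank_ker
  have h2 : Module.finrank ℝ (LinearMap.range P.A.mulVecLin) = n := P.full_rank
  rw [h2, Module.finrank_fin_fun] at h1
  have h3 : LinearMap.ker P.A.mulVecLin = ⊥ := Submodule.finrank_eq_zero.1 (by omega)
  exact LinearMap.ker_eq_bot.1 h3

theorem LinProg.convex_interior (P : LinProg m n) : Convex ℝ P.interior := by
  intro x hx y hy a b ha hb hab
  refine ⟨?_, fun i => (ordConnected_openDom _ _).convex (hx.2 i) (hy.2 i) ha hb hab⟩
  rw [mulVec_add, mulVec_smul, mulVec_smul, hx.1, hy.1, ← add_smul, hab, one_smul]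

theorem sqrtHess_pos {P : LinProg m n} {φ : Fin m → ℝ → ℝ}
    (hφ : ∀ i, IsSelfConcordantBarrier (P.l i) (P.u i) (φ i)) {x : Fin m → ℝ}
    (hx : x ∈ P.interior) (i : Fin m) : 0 < sqrtHess φ x i :=
  Real.sqrt_pos.2 ((hφ i).hess_pos (P.not_line i) (hx.2 i))

/-- The rescaled constraint matrix `A_x = Φ''(x)^{-1/2} A`. -/
def scaledMatrix (A : Matrix (Fin m) (Fin n) ℝ) (φ : Fin m → ℝ → ℝ) (x : Fin m → ℝ) :
    Matrix (Fin m) (Fin n) ℝ :=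
  diagonal (fun i => (sqrtHess φ x i)⁻¹) * A

/-- The matrix `A_xᵀ W⁻¹ A_x` of the normal equations. -/
def normalMatrix (A : Matrix (Fin m) (Fin n) ℝ) (φ : Fin m → ℝ → ℝ) (x w : Fin m → ℝ) :
    Matrix (Fin n) (Fin n) ℝ :=
  (scaledMatrix A φ x)ᵀ * diagonal (fun i => (w i)⁻¹) * scaledMatrix A φ x

theorem projMatrix_eq (A : Matrix (Fin m) (Fin n) ℝ) (φ : Fin m → ℝ → ℝ) (x w : Fin m → ℝ) :
    projMatrix A φ x w = 1 - diagonal (fun i => (w i)⁻¹) * scaledMatrix A φ x *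
      (normalMatrix A φ x w)⁻¹ * (scaledMatrix A φ x)ᵀ := rfl

variable {P : LinProg m n} {φ : Fin m → ℝ → ℝ} {x w : Fin m → ℝ}

theorem isUnit_det_normalMatrix (hq : ∀ i, 0 < sqrtHess φ x i) (hw : ∀ i, 0 < w i) :
    IsUnit (normalMatrix P.A φ x w).det := by
  rw [← isUnit_iff_isUnit_det]
  have hinj : Function.Injective (scaledMatrix P.A φ x).mulVec := by
    intro y z h
    refine P.mulVec_injective (funext fun i => ?_)
    have := congrFun h i
    simp only [scaledMatrix, ← mulVec_mulVec, mulVec_diagonal] at this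
    exact mul_left_cancel₀ (inv_pos.2 (hq i)).ne' this
  have h := (PosDef.diagonal (fun i => inv_pos.2 (hw i))).conjTranspose_mul_mul_same hinj
  rw [conjTranspose_eq_transpose_of_trivial] at h
  exact h.isUnit

theorem projMatrix_mul (hq : ∀ i, 0 < sqrtHess φ x i) (hw : ∀ i, 0 < w i) :
    projMatrix P.A φ x w * (diagonal (fun i => (w i)⁻¹) * scaledMatrix P.A φ x) = 0 := by
  have h := nonsing_inv_mul _ (isUnit_det_normalMatrix (P := P) hq hw)
  rw [projMatrix_eq, Matrix.sub_mul, Matrix.one_mul, sub_eq_zero]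
  calc _ = diagonal (fun i => (w i)⁻¹) * scaledMatrix P.A φ x *
        ((normalMatrix P.A φ x w)⁻¹ * normalMatrix P.A φ x w) := by rw [h, Matrix.mul_one]
    _ = _ := by simp only [normalMatrix, Matrix.mul_assoc]

theorem transpose_scaledMatrix_mul_projMatrix (hq : ∀ i, 0 < sqrtHess φ x i)
    (hw : ∀ i, 0 < w i) : (scaledMatrix P.A φ x)ᵀ * projMatrix P.A φ x w = 0 := by
  have h := mul_nonsing_inv _ (isUnit_det_normalMatrix (P := P) hq hw)
  rw [projMatrix_eq, Matrix.mul_sub, Matrix.mul_one, sub_eq_zero]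
  calc _ = (normalMatrix P.A φ x w * (normalMatrix P.A φ x w)⁻¹) * (scaledMatrix P.A φ x)ᵀ := by
        rw [h, Matrix.one_mul]
    _ = _ := by simp only [normalMatrix, Matrix.mul_assoc]

theorem transpose_mulVec_newtonStep (hq : ∀ i, 0 < sqrtHess φ x i) (hw : ∀ i, 0 < w i) (t : ℝ) :
    P.Aᵀ *ᵥ newtonStep P φ t x w = 0 := by
  set p : Fin m → ℝ := fun j => penalizedGrad P.c φ t x w j / (w j * sqrtHess φ x j) with hp
  have h1 : newtonStep P φ t x w =
      -(diagonal (fun i => (sqrtHess φ x i)⁻¹) *ᵥ (projMatrix P.A φ x w *ᵥ p)) := by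
    ext i
    rw [Pi.neg_apply, mulVec_diagonal, newtonStep]
  have h2 : P.Aᵀ * diagonal (fun i => (sqrtHess φ x i)⁻¹) = (scaledMatrix P.A φ x)ᵀ := by
    rw [scaledMatrix, transpose_mul, diagonal_transpose]
  rw [h1, mulVec_neg, mulVec_mulVec, mulVec_mulVec, h2, transpose_scaledMatrix_mul_projMatrix hq hw,
    zero_mulVec, neg_zero]

/-- The optimality condition of the Newton step: modulo the range of `A`, the gradient equals
`-W Φ''(x) h`. -/
theorem exists_penalizedGrad_sub_eq (hq : ∀ i, 0 < sqrtHess φ x i) (hw : ∀ i, 0 < w i) (t : ℝ) :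
    ∃ η : Fin n → ℝ, ∀ i, penalizedGrad P.c φ t x w i - (P.A *ᵥ η) i =
      -(w i * sqrtHess φ x i ^ 2 * newtonStep P φ t x w i) := by
  set p : Fin m → ℝ := fun j => penalizedGrad P.c φ t x w j / (w j * sqrtHess φ x j) with hp
  refine ⟨(normalMatrix P.A φ x w)⁻¹ *ᵥ ((scaledMatrix P.A φ x)ᵀ *ᵥ p), fun i => ?_⟩
  have h1 : newtonStep P φ t x w i =
      -((sqrtHess φ x i)⁻¹ * (projMatrix P.A φ x w *ᵥ p) i) := rfl
  set η := (normalMatrix P.A φ x w)⁻¹ *ᵥ ((scaledMatrix P.A φ x)ᵀ *ᵥ p) with hη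
  have h2 : (projMatrix P.A φ x w *ᵥ p) i =
      p i - (w i)⁻¹ * ((sqrtHess φ x i)⁻¹ * (P.A *ᵥ η) i) := by
    rw [projMatrix_eq, sub_mulVec, one_mulVec, Pi.sub_apply, ← mulVec_mulVec, ← mulVec_mulVec, ← hη,
      ← mulVec_mulVec, mulVec_diagonal, scaledMatrix, ← mulVec_mulVec, mulVec_diagonal]
  have hqi := (hq i).ne'
  have hwi := (hw i).ne'
  rw [h1, h2, hp]
  field_simp

/-- The local length of the Newton step is controlled by the centrality: the projection kills
`W⁻¹ A_x η`, so `η` may be subtracted before the operator norm is applied. -/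
theorem mixedNorm_newtonStep_le {C cγ t : ℝ} (hC : 0 ≤ C) (hcγ : 0 ≤ cγ)
    (hq : ∀ i, 0 < sqrtHess φ x i) (hw : ∀ i, 0 < w i)
    (hP : mixedOpNorm C w (projMatrix P.A φ x w) ≤ cγ) :
    mixedNorm C w (fun i => sqrtHess φ x i * newtonStep P φ t x w i) ≤
      cγ * centrality P φ C t x w := by
  have hw0 : ∀ i, 0 ≤ w i := fun i => (hw i).le
  rw [centrality, Real.mul_iInf_of_nonneg hcγ]
  refine le_ciInf fun η => ?_
  set p : Fin m → ℝ := fun j => penalizedGrad P.c φ t x w j / (w j * sqrtHess φ x j) with hp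
  set r : Fin m → ℝ :=
    fun i => (penalizedGrad P.c φ t x w i - (P.A *ᵥ η) i) / (w i * sqrtHess φ x i) with hr
  have h1 : r = p - (diagonal (fun i => (w i)⁻¹) * scaledMatrix P.A φ x) *ᵥ η := by
    ext i
    rw [Pi.sub_apply, scaledMatrix, ← mulVec_mulVec, mulVec_diagonal, ← mulVec_mulVec,
      mulVec_diagonal, hr, hp]
    have hqi := (hq i).ne'
    have hwi := (hw i).ne'
    field_simp
  have h2 : projMatrix P.A φ x w *ᵥ r = projMatrix P.A φ x w *ᵥ p := by
    rw [h1, mulVec_sub, mulVec_mulVec, projMatrix_mul hq hw, zero_mulVec, sub_zero]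
  have h3 : ∀ i, |sqrtHess φ x i * newtonStep P φ t x w i| ≤ |(projMatrix P.A φ x w *ᵥ r) i| := by
    intro i
    have h4 : newtonStep P φ t x w i =
      -((sqrtHess φ x i)⁻¹ * (projMatrix P.A φ x w *ᵥ p) i) := rfl
    rw [h4, h2, mul_neg, abs_neg, mul_inv_cancel_left₀ (hq i).ne']
  exact (mixedNorm_mono hC hw0 h3).trans ((mixedNorm_mulVec_le hC hw0 _ r).trans
    (mul_le_mul_of_nonneg_right hP (mixedNorm_nonneg hC w r)))

theorem centrality_nonneg {C : ℝ} (hC : 0 ≤ C) (t : ℝ) : 0 ≤ centrality P φ C t x w :=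
  Real.iInf_nonneg fun _ => mixedNorm_nonneg hC _ _

theorem centrality_le {C : ℝ} (hC : 0 ≤ C) (t : ℝ) (η : Fin n → ℝ) :
    centrality P φ C t x w ≤ mixedNorm C w
      (fun i => (penalizedGrad P.c φ t x w i - (P.A *ᵥ η) i) / (w i * sqrtHess φ x i)) :=
  ciInf_le ⟨0, by rintro _ ⟨η, rfl⟩; exact mixedNorm_nonneg hC _ _⟩ η

end Newton

/-! ### The potential and the game of chasing zero -/

theorem fderiv_potential (μ : ℝ) (z y : Fin m → ℝ) :
    fderiv ℝ (potential μ) z y =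
      ∑ i, μ * (Real.exp (μ * z i) - Real.exp (-(μ * z i))) * y i := by
  have hproj : ∀ i : Fin m, HasFDerivAt (fun v : Fin m → ℝ => μ * v i)
      (μ • ContinuousLinearMap.proj (R := ℝ) (φ := fun _ : Fin m => ℝ) i) z := fun i =>
    (ContinuousLinearMap.proj (R := ℝ) (φ := fun _ : Fin m => ℝ) i).hasFDerivAt.const_mul μ
  have h : HasFDerivAt (potential μ) (∑ i, (Real.exp (μ * z i) •
      (μ • ContinuousLinearMap.proj (R := ℝ) (φ := fun _ : Fin m => ℝ) i) +
      Real.exp (-(μ * z i)) • -(μ • ContinuousLinearMap.proj (R := ℝ) (φ := fun _ : Fin m => ℝ) i)))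
      z :=
    HasFDerivAt.fun_sum fun i _ => (hproj i).exp.add (hproj i).fun_neg.exp
  rw [h.fderiv]
  simp only [_root_.sum_apply, _root_.add_apply,
    _root_.smul_apply, _root_.neg_apply, ContinuousLinearMap.proj_apply,
    smul_eq_mul]
  exact Finset.sum_congr rfl fun i _ => by ring

theorem exp_add_exp_neg_le (a : ℝ) :
    Real.exp a + Real.exp (-a) ≤ |Real.exp a - Real.exp (-a)| + 2 := by
  rcases le_total 0 a with h | h
  · have h1 : Real.exp (-a) ≤ 1 := Real.exp_le_one_iff.2 (by linarith)
    linarith [le_abs_self (Real.exp a - Real.exp (-a))]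
  · have h1 : Real.exp a ≤ 1 := Real.exp_le_one_iff.2 h
    linarith [neg_abs_le (Real.exp a - Real.exp (-a))]

theorem abs_exp_sub_exp_le {a b θ : ℝ} (hθ : θ ≤ 1) (h : |b - a| ≤ θ) :
    |Real.exp b - Real.exp a| ≤ (θ + θ ^ 2) * Real.exp a := by
  have h1 := Real.abs_exp_sub_one_sub_id_le (h.trans hθ)
  have h2 : (b - a) ^ 2 ≤ θ ^ 2 := by
    rw [← sq_abs]; exact pow_le_pow_left₀ (abs_nonneg _) h 2
  have h3 : |Real.exp (b - a) - 1| ≤ θ + θ ^ 2 := by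
    have := abs_add_le (Real.exp (b - a) - 1 - (b - a)) (b - a)
    rw [sub_add_cancel] at this
    linarith
  have h4 : Real.exp b - Real.exp a = (Real.exp (b - a) - 1) * Real.exp a := by
    rw [sub_mul, ← Real.exp_add, sub_add_cancel, one_mul]
  rw [h4, abs_mul, abs_of_pos (Real.exp_pos a)]
  exact mul_le_mul_of_nonneg_right h3 (Real.exp_pos a).le

/-- The increment of one summand of the potential from `v` to `y`, compared with the linearization
at a third point `z` close to `y`. -/
theorem exp_add_exp_neg_sub_le {μ v y z θ : ℝ} (hμ : 0 ≤ μ) (hθ1 : θ ≤ 1)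
    (h : μ * |y - z| ≤ θ) :
    Real.exp (μ * y) + Real.exp (-(μ * y)) - (Real.exp (μ * v) + Real.exp (-(μ * v))) ≤
      μ * (Real.exp (μ * z) - Real.exp (-(μ * z))) * (y - v) +
      (θ + θ ^ 2) * ((|μ * (Real.exp (μ * z) - Real.exp (-(μ * z)))| + 2 * μ) * |y - v|) := by
  have hθ0 : 0 ≤ θ := (mul_nonneg hμ (abs_nonneg _)).trans h
  have hd : |μ * y - μ * z| ≤ θ := by rwa [← mul_sub, abs_mul, abs_of_nonneg hμ]
  have hd' : |-(μ * y) - -(μ * z)| ≤ θ := by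
    rwa [neg_sub_neg, abs_sub_comm]
  have e1 := abs_exp_sub_exp_le hθ1 hd
  have e2 := abs_exp_sub_exp_le hθ1 hd'
  -- convexity: the increment is at most the slope at the end `y` times the displacement
  have c1 : Real.exp (μ * y) - Real.exp (μ * v) ≤ Real.exp (μ * y) * (μ * (y - v)) := by
    have h1 := Real.add_one_le_exp (μ * v - μ * y)
    have h2 : Real.exp (μ * v) = Real.exp (μ * y) * Real.exp (μ * v - μ * y) := by
      rw [← Real.exp_add]; ring_nf
    rw [h2]
    nlinarith [Real.exp_pos (μ * y)]
  have c2 : Real.exp (-(μ * y)) - Real.exp (-(μ * v)) ≤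
      Real.exp (-(μ * y)) * (-(μ * (y - v))) := by
    have h1 := Real.add_one_le_exp (μ * y - μ * v)
    have h2 : Real.exp (-(μ * v)) = Real.exp (-(μ * y)) * Real.exp (μ * y - μ * v) := by
      rw [← Real.exp_add]; ring_nf
    rw [h2]
    nlinarith [Real.exp_pos (-(μ * y))]
  set E := Real.exp (μ * z)
  set E' := Real.exp (-(μ * z))
  set F := Real.exp (μ * y)
  set F' := Real.exp (-(μ * y))
  have s1 : |(F - E) - (F' - E')| ≤ (θ + θ ^ 2) * (E + E') := by
    have := abs_sub (F - E) (F' - E')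
    linarith
  have s2 : μ * (E + E') ≤ |μ * (E - E')| + 2 * μ := by
    have := mul_le_mul_of_nonneg_left (exp_add_exp_neg_le (μ * z)) hμ
    rw [abs_mul, abs_of_nonneg hμ]
    linarith
  have s3 : ((F - E) - (F' - E')) * (μ * (y - v)) ≤
      (θ + θ ^ 2) * ((|μ * (E - E')| + 2 * μ) * |y - v|) := by
    calc ((F - E) - (F' - E')) * (μ * (y - v))
        ≤ |((F - E) - (F' - E')) * (μ * (y - v))| := le_abs_self _
      _ = |(F - E) - (F' - E')| * (μ * |y - v|) := by
          rw [abs_mul, abs_mul μ, abs_of_nonneg hμ]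
      _ ≤ (θ + θ ^ 2) * (E + E') * (μ * |y - v|) := by gcongr
      _ = (θ + θ ^ 2) * (μ * (E + E') * |y - v|) := by ring
      _ ≤ _ := by gcongr
  nlinarith [s3, c1, c2]

theorem norm_le_of_potential_le {μ B : ℝ} (hμ : 0 < μ) (hB1 : 1 ≤ B) {v : Fin m → ℝ}
    (h : potential μ v ≤ B) : ‖v‖ ≤ Real.log B / μ := by
  have hB : 0 < B := by linarith
  refine (pi_norm_le_iff_of_nonneg (div_nonneg (Real.log_nonneg hB1) hμ.le)).2 fun i => ?_
  have h1 : Real.exp (μ * v i) + Real.exp (-(μ * v i)) ≤ B :=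
    (Finset.single_le_sum (f := fun i => Real.exp (μ * v i) + Real.exp (-(μ * v i)))
      (fun i _ => by positivity) (Finset.mem_univ i)).trans h
  have h2 := (Real.le_log_iff_exp_le hB).2
    (show Real.exp (μ * v i) ≤ B by linarith [Real.exp_pos (-(μ * v i))])
  have h3 := (Real.le_log_iff_exp_le hB).2
    (show Real.exp (-(μ * v i)) ≤ B by linarith [Real.exp_pos (μ * v i)])
  rw [le_div_iff₀ hμ, Real.norm_eq_abs]
  calc |v i| * μ = |μ * v i| := by rw [abs_mul, abs_of_pos hμ, mul_comm]
    _ ≤ Real.log B := abs_le.2 ⟨by linarith, h2⟩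

/-- One round of the game of chasing zero. An adversary moves `v` by `u ∈ U` and reveals only an
approximation `z` of the result; the player answers with `(1 + ε) d`, where `d ∈ U` minimizes the
linearized potential at `z`. Since `-u` is a competitor of `d`, the linear terms add up to at most
`-ε` times the dual norm of the gradient. This dominates the second-order terms once the potential
exceeds a multiple of `m τ`, where `τ` measures how far `U` is from a cube. -/
theorem potential_le_max {μ ε R ρ τ : ℝ} (hμ : 0 < μ) (hε : 0 < ε) (hε1 : ε ≤ 1 / 10)
    (hμR : μ * R = ε / 12) (hρ : 0 ≤ ρ) (hρR : ρ ≤ R) (hτ : 0 < τ) {U : Set (Fin m → ℝ)}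
    (hbox : ∀ y ∈ U, ‖y‖ ≤ ρ)
    (hsolid : ∀ y ∈ U, ∀ y' : Fin m → ℝ, (∀ i, |y' i| ≤ |y i|) → y' ∈ U)
    (hinner : ∀ y : Fin m → ℝ, ‖y‖ ≤ ρ / τ → y ∈ U)
    {v u d z : Fin m → ℝ} (hu : u ∈ U) (hd : d ∈ U) (hz : ‖z - (v + u)‖ ≤ R)
    (hmin : IsMinOn (fun y => fderiv ℝ (potential μ) z y) U d) :
    potential μ (v + u + (1 + ε) • d) ≤ max (potential μ v) (4 * m * (1 + τ)) := by
  set G : Fin m → ℝ := fun i => μ * (Real.exp (μ * z i) - Real.exp (-(μ * z i))) with hG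
  set D : ℝ := -∑ i, G i * d i with hD
  have hmin' : ∀ y ∈ U, -D ≤ ∑ i, G i * y i := by
    intro y hy
    have := isMinOn_iff.1 hmin y hy
    rw [fderiv_potential, fderiv_potential] at this
    rw [hD, neg_neg]
    exact this
  have hdual : ∀ y ∈ U, ∑ i, |G i| * |y i| ≤ D := by
    intro y hy
    -- `U` is invariant under sign changes, so the dual norm controls the sum of absolute values
    have h1 := hmin' (fun i => if 0 ≤ G i then -|y i| else |y i|)
      (hsolid y hy _ fun i => by split_ifs <;> simp)
    have h2 : ∑ i, G i * (if 0 ≤ G i then -|y i| else |y i|) = -∑ i, |G i| * |y i| := by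
      rw [← Finset.sum_neg_distrib]
      refine Finset.sum_congr rfl fun i _ => ?_
      split_ifs with h
      · rw [abs_of_nonneg h]; ring
      · rw [abs_of_neg (not_le.1 h)]; ring
    rw [h2] at h1
    linarith
  have hρτ : 0 ≤ ρ / τ := div_nonneg hρ hτ.le
  have hgrad : (∑ i, |G i|) * (ρ / τ) ≤ D := by
    have h1 := hdual (fun _ => ρ / τ) (hinner _ ((pi_norm_const_le _).trans
      (by rw [Real.norm_of_nonneg hρτ])))
    rwa [abs_of_nonneg hρτ, ← Finset.sum_mul] at h1
  have hpz : μ * (potential μ z - 2 * m) ≤ ∑ i, |G i| := by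
    have : potential μ z ≤ ∑ i, (|G i| / μ + 2) := by
      refine Finset.sum_le_sum fun i _ => ?_
      rw [hG, abs_mul, abs_of_pos hμ, mul_div_cancel_left₀ _ hμ.ne']
      exact exp_add_exp_neg_le _
    rw [Finset.sum_add_distrib, ← Finset.sum_div, Finset.sum_const, Finset.card_univ,
      Fintype.card_fin, nsmul_eq_mul] at this
    have h2 : potential μ z - 2 * m ≤ (∑ i, |G i|) / μ := by linarith
    rw [le_div_iff₀ hμ] at h2
    linarith
  set y := v + u + (1 + ε) • d with hy
  have hui : ∀ i, |u i| ≤ ρ := fun i => (norm_le_pi_norm u i).trans (hbox u hu)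
  have hdi : ∀ i, |d i| ≤ ρ := fun i => (norm_le_pi_norm d i).trans (hbox d hd)
  have hΔ : ∀ i, |y i - v i| ≤ |u i| + (1 + ε) * |d i| := by
    intro i
    have h1 : y i - v i = u i + (1 + ε) * d i := by simp [hy]; ring
    rw [h1, ← abs_of_pos (show 0 < 1 + ε by linarith), ← abs_mul,
      abs_of_pos (show 0 < 1 + ε by linarith)]
    exact abs_add_le _ _
  set θ := 7 / 40 * ε with hθ
  -- `(2 + ε) ε / 12 ≤ 7 ε / 40` for `ε ≤ 1/10`, so the potential varies little between `z` and `y`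
  have hclose : ∀ i, μ * |y i - z i| ≤ θ := by
    intro i
    have h1 : |z i - (v i + u i)| ≤ R := (norm_le_pi_norm (z - (v + u)) i).trans hz
    have h2 : y i - z i = (1 + ε) * d i - (z i - (v i + u i)) := by simp [hy]; ring
    have h3 : |y i - z i| ≤ (2 + ε) * R := by
      rw [h2]
      refine (abs_sub _ _).trans ?_
      rw [abs_mul, abs_of_pos (show 0 < 1 + ε by linarith)]
      nlinarith [hdi i]
    calc μ * |y i - z i| ≤ μ * ((2 + ε) * R) := by gcongr
      _ = (2 + ε) * (ε / 12) := by rw [← hμR]; ring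
      _ ≤ θ := by rw [hθ]; nlinarith
  have hθ1 : θ + θ ^ 2 ≤ 9 / 50 * ε := by rw [hθ]; nlinarith
  have hθ2 : θ ≤ 1 := by rw [hθ]; linarith
  have hincr : potential μ y - potential μ v ≤
      ∑ i, (G i * (y i - v i) + (9 / 50 * ε) * ((|G i| + 2 * μ) * |y i - v i|)) := by
    rw [potential, potential, ← Finset.sum_sub_distrib]
    refine Finset.sum_le_sum fun i _ => (exp_add_exp_neg_sub_le hμ.le hθ2 (hclose i)).trans ?_
    refine add_le_add le_rfl (mul_le_mul_of_nonneg_right hθ1 ?_)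
    positivity
  rw [Finset.sum_add_distrib, ← Finset.mul_sum] at hincr
  have hlin : ∑ i, G i * (y i - v i) ≤ -ε * D := by
    have h1 : ∑ i, G i * (y i - v i) = ∑ i, G i * u i + (1 + ε) * ∑ i, G i * d i := by
      rw [Finset.mul_sum, ← Finset.sum_add_distrib]
      refine Finset.sum_congr rfl fun i _ => ?_
      simp [hy]; ring
    have h2 : ∑ i, G i * u i ≤ D := (Finset.sum_le_sum fun i _ => by
      rw [← abs_mul]; exact le_abs_self _).trans (hdual u hu)
    have h3 : ∑ i, G i * d i = -D := by rw [hD, neg_neg]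
    rw [h1, h3]
    linarith
  have hD0 : 0 ≤ D := le_trans (by positivity) hgrad
  have hquad : ∑ i, (|G i| + 2 * μ) * |y i - v i| ≤ 21 / 10 * D + 21 / 5 * μ * ρ * m := by
    have h1 : ∀ i, (|G i| + 2 * μ) * |y i - v i| ≤
        (|G i| * |u i| + (1 + ε) * (|G i| * |d i|)) + 21 / 5 * μ * ρ := by
      intro i
      have h2 := mul_le_mul_of_nonneg_left (hΔ i) (abs_nonneg (G i))
      have h3 : |y i - v i| ≤ 21 / 10 * ρ := by
        refine (hΔ i).trans ?_
        nlinarith [hui i, hdi i, abs_nonneg (d i)]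
      have h4 := mul_le_mul_of_nonneg_left h3 (show 0 ≤ 2 * μ by linarith)
      nlinarith
    refine (Finset.sum_le_sum fun i _ => h1 i).trans ?_
    rw [Finset.sum_add_distrib, Finset.sum_add_distrib, ← Finset.mul_sum, Finset.sum_const,
      Finset.card_univ, Fintype.card_fin, nsmul_eq_mul]
    have h5 := hdual u hu
    have h6 := mul_le_mul_of_nonneg_left (hdual d hd) (show 0 ≤ 1 + ε by linarith)
    nlinarith
  -- a large potential at `z` makes the linear decrease dominate; a small one at most doubles
  rcases le_or_gt (2 * m + 2 * m * τ) (potential μ z) with hcase | hcase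
  · refine le_max_of_le_left ?_
    have h1 : 2 * (μ * ρ * m) ≤ D := by
      refine le_trans ?_ hgrad
      have h2 : μ * (2 * m * τ) ≤ ∑ i, |G i| :=
        le_trans (mul_le_mul_of_nonneg_left (by linarith) hμ.le) hpz
      calc 2 * (μ * ρ * m) = μ * (2 * m * τ) * (ρ / τ) := by field_simp
        _ ≤ _ := mul_le_mul_of_nonneg_right h2 hρτ
    have h2 := mul_le_mul_of_nonneg_left hquad (show 0 ≤ 9 / 50 * ε by linarith)
    have h3 : 0 ≤ ε * (D - 2 * (μ * ρ * m)) := mul_nonneg hε.le (by linarith)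
    have h4 : 0 ≤ ε * D := mul_nonneg hε.le hD0
    nlinarith
  · refine le_max_of_le_right ?_
    have h1 : potential μ y ≤ ∑ i, 2 * (Real.exp (μ * z i) + Real.exp (-(μ * z i))) := by
      refine Finset.sum_le_sum fun i _ => ?_
      have hd1 : |μ * y i - μ * z i| ≤ θ := by
        rw [← mul_sub, abs_mul, abs_of_pos hμ]; exact hclose i
      have hd2 : |-(μ * y i) - -(μ * z i)| ≤ θ := by rwa [neg_sub_neg, abs_sub_comm]
      have e1 := (abs_le.1 (abs_exp_sub_exp_le hθ2 hd1)).2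
      have e2 := (abs_le.1 (abs_exp_sub_exp_le hθ2 hd2)).2
      have h5 : θ + θ ^ 2 ≤ 1 := by linarith
      nlinarith [Real.exp_pos (μ * z i), Real.exp_pos (-(μ * z i))]
    rw [← Finset.mul_sum] at h1
    have h2 : ∑ i, (Real.exp (μ * z i) + Real.exp (-(μ * z i))) = potential μ z := rfl
    rw [h2] at h1
    linarith

/-! ### Sensitivity of the weight function -/

theorem le_exp_mul_of_abs_log_sub_le {a b κ : ℝ} (ha : 0 < a) (hb : 0 < b)
    (h : |Real.log a - Real.log b| ≤ κ) : a ≤ Real.exp κ * b := by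
  have h1 := (abs_le.1 h).2
  calc a = Real.exp (Real.log a) := (Real.exp_log ha).symm
    _ ≤ Real.exp (κ + Real.log b) := Real.exp_le_exp.2 (by linarith)
    _ = Real.exp κ * b := by rw [Real.exp_add, Real.exp_log hb]

/-- The derivative of `log g` along a segment. -/
theorem hasDerivWithinAt_log_weight {P : LinProg m n} {g : (Fin m → ℝ) → (Fin m → ℝ)}
    (hpos : ∀ x ∈ P.interior, ∀ i, 0 < g x i)
    {J : (Fin m → ℝ) → Matrix (Fin m) (Fin m) ℝ}
    (hJ : ∀ x ∈ P.interior,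
      HasFDerivWithinAt g (LinearMap.toContinuousLinearMap (J x).mulVecLin) P.interior x)
    {x h : Fin m → ℝ} (hseg : ∀ s ∈ Set.Icc (0 : ℝ) 1, x + s • h ∈ P.interior)
    {s : ℝ} (hs : s ∈ Set.Icc (0 : ℝ) 1) :
    HasDerivWithinAt (fun s : ℝ => vecLog (g (x + s • h)))
      (fun i => (J (x + s • h)).mulVec h i / g (x + s • h) i) (Set.Icc 0 1) s := by
  have h1 : HasDerivWithinAt (fun s : ℝ => x + s • h) h (Set.Icc 0 1) s := by
    simpa using (((hasDerivAt_id s).smul_const h).const_add x).hasDerivWithinAt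
  have h2 : HasDerivWithinAt (fun s : ℝ => g (x + s • h)) ((J (x + s • h)).mulVec h)
      (Set.Icc 0 1) s := by
    have h3 := hJ _ (hseg s hs)
    exact h3.comp_hasDerivWithinAt s h1 hseg
  rw [hasDerivWithinAt_pi] at h2 ⊢
  exact fun i => (h2 i).log (hpos _ (hseg s hs) i).ne'

/-- The logarithmic derivative of a weight function in a direction `h`, in the mixed norm. -/
theorem mixedNorm_log_deriv_le {C cδ : ℝ} (hC : 0 ≤ C) {γ q h : Fin m → ℝ}
    (hγ : ∀ i, 0 < γ i) (hq : ∀ i, 0 < q i) {J : Matrix (Fin m) (Fin m) ℝ}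
    (hJ : mixedOpNorm C γ (Matrix.diagonal (fun i => (γ i)⁻¹) * J *
      Matrix.diagonal (fun i => (q i)⁻¹)) ≤ cδ) :
    mixedNorm C γ (fun i => J.mulVec h i / γ i) ≤ cδ * mixedNorm C γ (fun i => q i * h i) := by
  have h1 : (fun i => J.mulVec h i / γ i) = (Matrix.diagonal (fun i => (γ i)⁻¹) * J *
      Matrix.diagonal (fun i => (q i)⁻¹)).mulVec (fun i => q i * h i) := by
    have h2 : (Matrix.diagonal (fun i => (q i)⁻¹)).mulVec (fun i => q i * h i) = h := by
      ext i
      rw [Matrix.mulVec_diagonal, inv_mul_cancel_left₀ (hq i).ne']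
    rw [← Matrix.mulVec_mulVec, h2, ← Matrix.mulVec_mulVec]
    ext i
    rw [Matrix.mulVec_diagonal, div_eq_inv_mul]
  rw [h1]
  exact (mixedNorm_mulVec_le hC (fun i => (hγ i).le) _ _).trans
    (mul_le_mul_of_nonneg_right hJ (mixedNorm_nonneg hC _ _))

set_option synthInstance.maxHeartbeats 200000 in
/-- The change of `log g` along a step `h` that is short in the local norm. The bound on the
derivative is available in the norm of the weight `g`, which is comparable to the norm of `w` only
as long as `log g` has not moved by more than `β`; the strict inequality `hβ` closes this
circle. -/
theorem mixedNorm_log_weight_sub_le {P : LinProg m n} {φ : Fin m → ℝ → ℝ}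
    (hφ : ∀ i, IsSelfConcordantBarrier (P.l i) (P.u i) (φ i))
    {C : ℝ} (hC : 0 ≤ C) {g : (Fin m → ℝ) → (Fin m → ℝ)} {c₁ cγ cδ : ℝ}
    (hg : IsWeightFunction P φ C g c₁ cγ cδ) (hcδ : 0 ≤ cδ)
    {x w h : Fin m → ℝ} (hx : x ∈ P.interior) (hx' : x + h ∈ P.interior) (hw : ∀ i, 0 < w i)
    {r κ β a T : ℝ} (hr : ∀ i, sqrtHess φ x i * |h i| ≤ r) (hr1 : r < 1)
    (hκ : ‖logError g x w‖ ≤ κ) (ha : 1 ≤ a) (haκ : Real.exp (κ + β) ≤ a ^ 2)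
    (hT : a ^ 2 * cδ * mixedNorm C w (fun i => sqrtHess φ x i * h i) ≤ (1 - r) * T)
    (hβ : T < β) :
    mixedNorm C w (vecLog (g (x + h)) - vecLog (g x)) ≤ T := by
  have hw0 : ∀ i, 0 ≤ w i := fun i => (hw i).le
  have ha0 : 0 ≤ a := by linarith
  have h1r : 0 < 1 - r := by linarith
  set S := mixedNorm C w (fun i => sqrtHess φ x i * h i) with hS
  have hS0 : 0 ≤ S := mixedNorm_nonneg hC _ _
  obtain ⟨J, hJ⟩ := hg.step
  have hseg : ∀ s ∈ Set.Icc (0 : ℝ) 1, x + s • h ∈ P.interior := fun s hs =>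
    P.convex_interior.add_smul_mem hx hx' hs
  set F : ℝ → (Fin m → ℝ) := fun s => vecLog (g (x + s • h)) - vecLog (g x) with hF
  set F' : ℝ → (Fin m → ℝ) := fun s i => (J (x + s • h)).mulVec h i / g (x + s • h) i with hF'
  have hFderiv : ∀ s ∈ Set.Icc (0 : ℝ) 1, HasDerivWithinAt F (F' s) (Set.Icc 0 1) s := fun s hs =>
    (hasDerivWithinAt_log_weight hg.pos (fun x hx => (hJ x hx).1) hseg hs).sub_const _
  set L := mixedEmbedding C w with hL
  have hLnorm : ∀ y, ‖L y‖ = mixedNorm C w y := norm_mixedEmbedding hC hw0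
  have hLderiv : ∀ s ∈ Set.Icc (0 : ℝ) 1,
      HasDerivWithinAt (fun s => L (F s)) (L (F' s)) (Set.Icc 0 1) s := fun s hs =>
    L.hasFDerivAt.comp_hasDerivWithinAt s (hFderiv s hs)
  have hF0 : F 0 = 0 := by simp [hF]
  have hbound : ∀ s ∈ Set.Icc (0 : ℝ) 1, ‖F s‖ ≤ β → mixedNorm C w (F' s) ≤ T := by
    intro s hs hFs
    have hy := hseg s hs
    set y := x + s • h with hydef
    have hq := sqrtHess_pos hφ hy
    have hlog : ∀ i, |Real.log (g y i) - Real.log (w i)| ≤ κ + β := by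
      intro i
      have h1 : |Real.log (g x i) - Real.log (w i)| ≤ κ :=
        (norm_le_pi_norm (logError g x w) i).trans hκ
      have h2 : |Real.log (g y i) - Real.log (g x i)| ≤ β :=
        (norm_le_pi_norm (F s) i).trans hFs
      have h3 := abs_add_le (Real.log (g x i) - Real.log (w i))
        (Real.log (g y i) - Real.log (g x i))
      rw [show Real.log (g x i) - Real.log (w i) + (Real.log (g y i) - Real.log (g x i)) =
        Real.log (g y i) - Real.log (w i) by ring] at h3
      linarith
    have hgy := hg.pos y hy
    have hgw : ∀ i, g y i ≤ a ^ 2 * w i := fun i =>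
      (le_exp_mul_of_abs_log_sub_le (hgy i) (hw i) (hlog i)).trans
        (mul_le_mul_of_nonneg_right haκ (hw0 i))
    have hwg : ∀ i, w i ≤ a ^ 2 * g y i := fun i =>
      (le_exp_mul_of_abs_log_sub_le (hw i) (hgy i) (by rw [abs_sub_comm]; exact hlog i)).trans
        (mul_le_mul_of_nonneg_right haκ (hgy i).le)
    have hlocal : mixedNorm C w (fun i => sqrtHess φ y i * h i) ≤ (1 - r)⁻¹ * S := by
      rw [hS, ← abs_of_pos (inv_pos.2 h1r), ← mixedNorm_smul hC hw0]
      refine mixedNorm_mono hC hw0 fun i => ?_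
      have h1 : √(iteratedDeriv 2 (φ i) (x i)) * |s * h i| ≤ r := by
        refine le_trans ?_ (hr i)
        rw [abs_mul, abs_of_nonneg hs.1]
        exact mul_le_mul_of_nonneg_left (mul_le_of_le_one_left (abs_nonneg _) hs.2)
          (Real.sqrt_nonneg _)
      have h2 := ((hφ i).sqrt_hess_add_bounds (P.not_line i) (hx.2 i) h1 hr1).1
      have h3 : sqrtHess φ y i ≤ (1 - r)⁻¹ * sqrtHess φ x i := by
        rw [← div_eq_inv_mul, le_div_iff₀ h1r, mul_comm]
        exact h2
      rw [Pi.smul_apply, smul_eq_mul, ← mul_assoc, abs_mul, abs_mul, abs_of_pos (hq i),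
        abs_of_nonneg (mul_nonneg (inv_pos.2 h1r).le (sqrtHess_pos hφ hx i).le)]
      exact mul_le_mul_of_nonneg_right h3 (abs_nonneg _)
    calc mixedNorm C w (F' s) ≤ a * mixedNorm C (g y) (F' s) :=
          mixedNorm_le_of_weight_le hC ha hwg _
      _ ≤ a * (cδ * mixedNorm C (g y) (fun i => sqrtHess φ y i * h i)) :=
          mul_le_mul_of_nonneg_left (mixedNorm_log_deriv_le hC hgy hq (hJ y hy).2) ha0
      _ ≤ a * (cδ * (a * mixedNorm C w (fun i => sqrtHess φ y i * h i))) := by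
          gcongr
          exact mixedNorm_le_of_weight_le hC ha hgw _
      _ ≤ a * (cδ * (a * ((1 - r)⁻¹ * S))) := by gcongr
      _ = (a ^ 2 * cδ * S) / (1 - r) := by rw [div_eq_mul_inv]; ring
      _ ≤ T := by rw [div_le_iff₀ h1r]; linarith
  have hβ0 : 0 ≤ β := by
    by_contra hneg
    have h1 : 0 ≤ (1 - r) * T := le_trans (by positivity) hT
    have h2 : 0 ≤ T := nonneg_of_mul_nonneg_right h1 h1r
    linarith
  -- the change of `log g` cannot overtake `β s`, as at a point of contact its speed is at most `T < β`
  have hle : ∀ s ∈ Set.Icc (0 : ℝ) 1, ‖L (F s)‖ ≤ β * s := by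
    refine image_norm_le_of_norm_deriv_right_lt_deriv_boundary (f' := fun s => L (F' s))
      (fun s hs => (hLderiv s hs).continuousWithinAt)
      (fun s hs => (hLderiv s ⟨hs.1, hs.2.le⟩).mono_of_mem_nhdsWithin ?_) ?_
      (B' := fun _ => β) (fun s => by simpa using (hasDerivAt_id s).const_mul β) ?_
    · exact mem_of_superset (Icc_mem_nhdsGE hs.2) (Set.Icc_subset_Icc_left hs.1)
    · simp [hF0]
    · intro s hs heq
      have h1 : ‖F s‖ ≤ β := by
        refine (norm_le_mixedNorm hC w (F s)).trans ?_
        rw [← hLnorm, heq]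
        exact mul_le_of_le_one_right hβ0 hs.2.le
      show ‖L (F' s)‖ < β
      rw [hLnorm]
      exact (hbound s ⟨hs.1, hs.2.le⟩ h1).trans_lt hβ
  have hfinal := norm_image_sub_le_of_norm_deriv_le_segment_01' hLderiv (C := T) fun s hs => by
    have hs' : s ∈ Set.Icc (0 : ℝ) 1 := ⟨hs.1, hs.2.le⟩
    rw [hLnorm]
    refine hbound s hs' ((norm_le_mixedNorm hC w (F s)).trans ?_)
    rw [← hLnorm]
    exact (hle s hs').trans (mul_le_of_le_one_right hβ0 hs.2.le)
  rw [hF0, map_zero, sub_zero, hLnorm] at hfinal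
  simpa [hF] using hfinal

/-! ### The centrality after one step -/

/-- The centrality after the Newton step `x ↦ x + h` and a multiplicative change `w ↦ e^{-e} w` of
the weights. The multiplier `η` of the Newton step serves as a witness: the residual splits into
the Taylor remainder of `φ'`, which is quadratic in `h`, and `(w' - w) φ'`, which the bound
`|φ'| ≤ √φ''` makes linear in `e`. -/
theorem centrality_step_le {P : LinProg m n} {φ : Fin m → ℝ → ℝ}
    (hφ : ∀ i, IsSelfConcordantBarrier (P.l i) (P.u i) (φ i)) {C : ℝ} (hC : 0 ≤ C) {t : ℝ}
    {x w e : Fin m → ℝ} (hx : x ∈ P.interior) (hw : ∀ i, 0 < w i) {s b : ℝ}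
    (hs : mixedNorm C w (fun i => sqrtHess φ x i * newtonStep P φ t x w i) ≤ s)
    (hs1 : s ≤ 1 / 100) (hb : ‖e‖ ≤ b) (hb1 : b ≤ 1 / 100) :
    centrality P φ C t (x + newtonStep P φ t x w) (fun i => Real.exp (Real.log (w i) - e i)) ≤
      (1 + b) * (3 * s * s + (1 + b) * mixedNorm C w e) := by
  have hw0 : ∀ i, 0 ≤ w i := fun i => (hw i).le
  have hb0 : 0 ≤ b := (norm_nonneg e).trans hb
  have hq := sqrtHess_pos hφ hx
  set h := newtonStep P φ t x w with hh
  set y : Fin m → ℝ := fun i => sqrtHess φ x i * h i with hy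
  have hyi : ∀ i, |y i| ≤ s := fun i =>
    (norm_le_pi_norm y i).trans ((norm_le_mixedNorm hC w y).trans hs)
  have hs0 : 0 ≤ s := (mixedNorm_nonneg hC w y).trans hs
  have hei : ∀ i, |e i| ≤ b := fun i => (norm_le_pi_norm e i).trans hb
  obtain ⟨η, hη⟩ := exists_penalizedGrad_sub_eq (P := P) hq hw t
  set w' : Fin m → ℝ := fun i => Real.exp (Real.log (w i) - e i) with hw'
  have hw'eq : ∀ i, w' i = w i * Real.exp (-e i) := fun i => by
    simp only [hw']
    rw [sub_eq_add_neg, Real.exp_add, Real.exp_log (hw i)]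
  have hexp : ∀ a : ℝ, |a| ≤ b → |Real.exp a - 1| ≤ (1 + b) * |a| := fun a ha => by
    have h1 := Real.abs_exp_sub_one_sub_id_le (ha.trans (hb1.trans (by norm_num)))
    have h2 := abs_add_le (Real.exp a - 1 - a) a
    rw [sub_add_cancel] at h2
    rw [← sq_abs] at h1
    nlinarith [abs_nonneg a]
  have hpoint : ∀ i, |(penalizedGrad P.c φ t (x + h) w' i - (P.A.mulVec η) i) /
      (w' i * sqrtHess φ (x + h) i)| ≤ 3 * s * |y i| + (1 + b) * |e i| := by
    intro i
    have hr : √(iteratedDeriv 2 (φ i) (x i)) * |h i| ≤ s := by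
      have h1 := hyi i
      rwa [hy, abs_mul, abs_of_pos (hq i)] at h1
    have hs1' : s < 1 := by linarith
    have hmem := (hφ i).add_mem (P.not_line i) (hx.2 i) (hr.trans_lt hs1')
    have hT := (hφ i).abs_deriv_add_sub_le (P.not_line i) (hx.2 i) hr hs1'
    have hB := ((hφ i).sqrt_hess_add_bounds (P.not_line i) (hx.2 i) hr hs1').2
    have hF := (hφ i).force _ hmem
    have hsq := Real.sq_sqrt ((hφ i).nonneg _ (hx.2 i))
    have hq' : 0 < √(iteratedDeriv 2 (φ i) (x i + h i)) :=
      Real.sqrt_pos.2 ((hφ i).hess_pos (P.not_line i) hmem)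
    have hηi := hη i
    simp only [penalizedGrad, sqrtHess, Pi.add_apply, hy] at hηi ⊢
    have hqi : 0 < √(iteratedDeriv 2 (φ i) (x i)) := hq i
    rw [hsq] at hηi
    set q := √(iteratedDeriv 2 (φ i) (x i))
    set q' := √(iteratedDeriv 2 (φ i) (x i + h i))
    set ψ := iteratedDeriv 2 (φ i) (x i)
    set p := deriv (φ i) (x i)
    set p' := deriv (φ i) (x i + h i)
    have hwe : w i = w' i * Real.exp (e i) := by
      rw [hw'eq, mul_assoc, ← Real.exp_add, neg_add_cancel, Real.exp_zero, mul_one]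
    have hw'pos : 0 < w' i := Real.exp_pos _
    have hnum : t * P.c i + w' i * p' - (P.A.mulVec η) i =
        w' i * (Real.exp (e i) * (p' - p - ψ * h i) - (Real.exp (e i) - 1) * p') := by
      have h1 : t * P.c i - (P.A.mulVec η) i = -(w i * ψ * h i) - w i * p := by linarith
      have h2 : t * P.c i + w' i * p' - (P.A.mulVec η) i =
        w i * (p' - p - ψ * h i) + (w' i - w i) * p' := by linarith
      rw [h2, hwe]
      ring
    rw [hnum, mul_div_mul_left _ _ hw'pos.ne', abs_div, abs_of_pos hq', div_le_iff₀ hq']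
    have he1 := hexp (e i) (hei i)
    have he2 : Real.exp (e i) ≤ 11 / 10 := by
      have h1 := (abs_le.1 he1).2
      nlinarith [hei i, abs_nonneg (e i)]
    have hrem : |p' - p - ψ * h i| ≤ 5 / 2 * s * |q * h i| * q' := by
      have h1s : 0 < 1 - s := by linarith
      have h3 : (q / (1 - s)) ^ 3 * |h i| ^ 2 ≤ 11 / 10 * q ^ 3 * |h i| ^ 2 := by
        have h5 : 1 ≤ 11 / 10 * (1 - s) ^ 3 := by
          have h6 : (99 / 100 : ℝ) ^ 3 ≤ (1 - s) ^ 3 :=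
            pow_le_pow_left₀ (by norm_num) (by linarith) 3
          norm_num at h6
          linarith
        have h4 : (q / (1 - s)) ^ 3 ≤ 11 / 10 * q ^ 3 := by
          rw [div_pow, div_le_iff₀ (by positivity)]
          nlinarith [pow_pos hqi 3]
        exact mul_le_mul_of_nonneg_right h4 (by positivity)
      have h7 : |q * h i| = q * |h i| := by rw [abs_mul, abs_of_pos hqi]
      calc |p' - p - ψ * h i| ≤ 2 * (q / (1 - s)) ^ 3 * |h i| ^ 2 := hT
        _ ≤ 11 / 5 * (q * |h i|) * (q * |h i|) * q := by linarith
        _ ≤ 11 / 5 * s * (q * |h i|) * ((1 + s) * q') := by gcongr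
        _ = 11 / 5 * (1 + s) * (s * (q * |h i|) * q') := by ring
        _ ≤ 5 / 2 * (s * (q * |h i|) * q') := by
            refine mul_le_mul_of_nonneg_right (by linarith) (by positivity)
        _ = 5 / 2 * s * |q * h i| * q' := by rw [h7]; ring
    calc |Real.exp (e i) * (p' - p - ψ * h i) - (Real.exp (e i) - 1) * p'|
        ≤ |Real.exp (e i) * (p' - p - ψ * h i)| + |(Real.exp (e i) - 1) * p'| := abs_sub _ _
      _ = Real.exp (e i) * |p' - p - ψ * h i| + |Real.exp (e i) - 1| * |p'| := by
          rw [abs_mul, abs_mul, abs_of_pos (Real.exp_pos _)]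
      _ ≤ 11 / 10 * (5 / 2 * s * |q * h i| * q') + (1 + b) * |e i| * q' := by gcongr
      _ ≤ (3 * s * |q * h i| + (1 + b) * |e i|) * q' := by
          have h8 : 0 ≤ s * |q * h i| * q' := by positivity
          linarith
  have hweight : ∀ i, w' i ≤ (1 + b) ^ 2 * w i := fun i => by
    have h1 := (abs_le.1 (hexp (-e i) (by rw [abs_neg]; exact hei i))).2
    rw [abs_neg] at h1
    rw [hw'eq, mul_comm]
    refine mul_le_mul_of_nonneg_right ?_ (hw0 i)
    nlinarith [hei i]
  have hw'0 : ∀ i, 0 ≤ w' i := fun i => (Real.exp_pos _).le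
  refine (centrality_le hC t η).trans ?_
  calc _ ≤ mixedNorm C w' ((3 * s) • (fun i => |y i|) + (1 + b) • (fun i => |e i|)) := by
        refine mixedNorm_mono hC hw'0 fun i => (hpoint i).trans (le_abs_self _)
    _ ≤ (1 + b) * mixedNorm C w ((3 * s) • (fun i => |y i|) + (1 + b) • (fun i => |e i|)) :=
        mixedNorm_le_of_weight_le hC (by linarith) hweight _
    _ ≤ (1 + b) * (3 * s * s + (1 + b) * mixedNorm C w e) := by
        refine mul_le_mul_of_nonneg_left ((mixedNorm_add_le hC hw0 _ _).trans ?_) (by linarith)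
        rw [mixedNorm_smul hC hw0, mixedNorm_smul hC hw0, abs_of_nonneg (by positivity),
          abs_of_nonneg (by linarith)]
        have h1 : mixedNorm C w (fun i => |y i|) ≤ s :=
          (mixedNorm_mono hC hw0 fun i => (abs_abs (y i)).le).trans hs
        have h2 : mixedNorm C w (fun i => |e i|) ≤ mixedNorm C w e :=
          mixedNorm_mono hC hw0 fun i => (abs_abs (e i)).le
        gcongr

/-! ### Constants and one step of the algorithm -/

theorem five_le_log {M : ℝ} (hM : 1 ≤ M) : 5 ≤ Real.log (400 * M) := by
  rw [Real.le_log_iff_exp_le (by linarith)]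
  have h1 : Real.exp 5 = Real.exp 1 ^ 5 := by rw [← Real.exp_nat_mul]; norm_num
  have h2 : Real.exp 1 ^ 5 ≤ (14 / 5 : ℝ) ^ 5 :=
    pow_le_pow_left₀ (Real.exp_pos 1).le (by linarith [Real.exp_one_lt_d9]) 5
  norm_num at h2
  linarith

/-- The mixed norm is at most `78 m` times the sup norm if the weights are bounded and `C` is of
order `m^{1/4}`. -/
theorem mixedNorm_le_card_mul_norm {C : ℝ} (hm : 1 ≤ (m : ℝ)) (hC0 : 0 ≤ C)
    (hC : C ≤ 48 * (m : ℝ) ^ (1 / 4 : ℝ)) {w : Fin m → ℝ} (hw : ∀ i, 0 ≤ w i)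
    (hw2 : ∀ i, w i ≤ 5 / 2) (y : Fin m → ℝ) : mixedNorm C w y ≤ 78 * m * ‖y‖ := by
  refine (mixedNorm_le_mul_norm hC0 hw y).trans (mul_le_mul_of_nonneg_right ?_ (norm_nonneg y))
  have h1 : (m : ℝ) ^ (1 / 4 : ℝ) ≤ √m := by
    rw [Real.sqrt_eq_rpow]
    exact Real.rpow_le_rpow_of_exponent_le hm (by norm_num)
  have h2 : ∑ i, w i ≤ (8 / 5) ^ 2 * m := by
    calc ∑ i, w i ≤ ∑ _i : Fin m, (5 / 2 : ℝ) := Finset.sum_le_sum fun i _ => hw2 i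
      _ = 5 / 2 * m := by simp [mul_comm]
      _ ≤ _ := by linarith
  have h3 : √(∑ i, w i) ≤ 8 / 5 * √m := by
    refine (Real.sqrt_le_sqrt h2).trans ?_
    rw [Real.sqrt_mul (by positivity), Real.sqrt_sq (by norm_num)]
  have h4 : C * √(∑ i, w i) ≤ 48 * √m * (8 / 5 * √m) := by
    gcongr
    linarith
  have h5 := Real.mul_self_sqrt (show (0 : ℝ) ≤ m by linarith)
  nlinarith

theorem exp_le_one_add_add_sq {a : ℝ} (h0 : 0 ≤ a) (h1 : a ≤ 1) :
    Real.exp a ≤ 1 + a + a ^ 2 := by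
  have := (abs_le.1 (Real.abs_exp_sub_one_sub_id_le (by rwa [abs_of_nonneg h0]))).2
  linarith

/-- The contraction `c_δ c_γ = 1 - k` absorbs the distortion of the norms along the Newton step. -/
theorem sensitivity_constant_le {k δ : ℝ} (hk0 : 0 ≤ k) (hk1 : k ≤ 1 / 5) (hδ0 : 0 ≤ δ)
    (hδk : δ ≤ k / 24000) :
    (1 + k / 19) ^ 2 * (1 - k) ≤ (1 - 5 / 4 * δ) * (1 - 7 / 8 * k) := by
  have h1 : (1 + k / 19) ^ 2 ≤ 1 + 53 / 500 * k := by nlinarith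
  have h2 : (1 + k / 19) ^ 2 * (1 - k) ≤ (1 + 53 / 500 * k) * (1 - k) :=
    mul_le_mul_of_nonneg_right h1 (by linarith)
  have h3 : 0 ≤ k * k := mul_nonneg hk0 hk0
  have h4 : 0 ≤ δ * k := mul_nonneg hδ0 hk0
  linarith

theorem centrality_constant_le {k δ : ℝ} (hk0 : 0 ≤ k) (hk1 : k ≤ 1 / 5) (hδ0 : 0 ≤ δ)
    (hδk : δ ≤ k / 24000) :
    (1 + 2 * δ) * (75 / 16 * δ + (1 + 2 * δ) * (1 - 3 / 8 * k)) ≤ 1 - 1 / 4 * k := by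
  have h0 : 0 ≤ δ * k := mul_nonneg hδ0 hk0
  have h1 : (1 + 2 * δ) * (75 / 16 * δ + (1 + 2 * δ) * (1 - 3 / 8 * k)) ≤
      (1 + 2 * δ) * (1 + 7 * δ - 3 / 8 * k) := by
    refine mul_le_mul_of_nonneg_left ?_ (by linarith)
    linarith
  have h2 : δ * δ ≤ δ * 1 := mul_le_mul_of_nonneg_left (by linarith) hδ0
  linarith

/-- Closeness of `log w` to `log g(x)` turns into the multiplicative bounds under which the slack
sensitivity of a weight function applies. -/
theorem weight_bounds {γ w : Fin m → ℝ} (hγ : ∀ i, 0 < γ i) (hw : ∀ i, 0 < w i) {κ : ℝ}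
    (hκ1 : κ ≤ 1 / 100) (h : ‖vecLog γ - vecLog w‖ ≤ κ) (i : Fin m) :
    4 / 5 * γ i ≤ w i ∧ w i ≤ 5 / 4 * γ i := by
  have hi : |Real.log (γ i) - Real.log (w i)| ≤ κ :=
    (norm_le_pi_norm (vecLog γ - vecLog w) i).trans h
  have hexp : Real.exp κ ≤ 5 / 4 := by
    refine (Real.exp_le_exp.2 hκ1).trans
      ((exp_le_one_add_add_sq (by norm_num) (by norm_num)).trans (by norm_num))
  have h1 := (le_exp_mul_of_abs_log_sub_le (hγ i) (hw i) hi).trans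
    (mul_le_mul_of_nonneg_right hexp (hw i).le)
  have h2 := (le_exp_mul_of_abs_log_sub_le (hw i) (hγ i) (by rwa [abs_sub_comm])).trans
    (mul_le_mul_of_nonneg_right hexp (hγ i).le)
  constructor <;> linarith

section Step

variable {P : LinProg m n} {φ : Fin m → ℝ → ℝ} {C t : ℝ} {x w : Fin m → ℝ}

theorem sqrtHess_mul_abs_le {y : Fin m → ℝ} (hC : 0 ≤ C) {s : ℝ}
    (hs : mixedNorm C w (fun i => sqrtHess φ x i * y i) ≤ s) (i : Fin m) :
    sqrtHess φ x i * |y i| ≤ s := by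
  have h1 := (norm_le_pi_norm (fun i => sqrtHess φ x i * y i) i).trans
    ((norm_le_mixedNorm hC w _).trans hs)
  have hq : 0 ≤ sqrtHess φ x i := Real.sqrt_nonneg _
  rwa [Real.norm_eq_abs, abs_mul, abs_of_nonneg hq] at h1

theorem add_newtonStep_mem_interior
    (hφ : ∀ i, IsSelfConcordantBarrier (P.l i) (P.u i) (φ i)) (hC : 0 ≤ C)
    (hx : x ∈ P.interior) (hw : ∀ i, 0 < w i)
    (hs : mixedNorm C w (fun i => sqrtHess φ x i * newtonStep P φ t x w i) < 1) :
    x + newtonStep P φ t x w ∈ P.interior := by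
  refine ⟨?_, fun i => (hφ i).add_mem (P.not_line i) (hx.2 i)
    ((sqrtHess_mul_abs_le hC le_rfl i).trans_lt hs)⟩
  rw [Matrix.mulVec_add, hx.1, transpose_mulVec_newtonStep (sqrtHess_pos hφ hx) hw, add_zero]

/-- Along the Newton step `log g` moves by less than the centrality, by a margin of relative size
`7/8 (1 - c_δ c_γ)`. -/
theorem mixedNorm_log_weight_newtonStep_le
    (hφ : ∀ i, IsSelfConcordantBarrier (P.l i) (P.u i) (φ i)) (hC : 0 ≤ C)
    {g : (Fin m → ℝ) → (Fin m → ℝ)} {c₁ cγ cδ : ℝ} (hg : IsWeightFunction P φ C g c₁ cγ cδ)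
    (hcδ : 0 ≤ cδ) (hx : x ∈ P.interior) (hw : ∀ i, 0 < w i) {k K R δ : ℝ}
    (hk : cδ * cγ = 1 - k) (hk0 : 0 < k) (hk1 : k ≤ 1 / 5) (hK : K ≤ k / 20) (hR0 : 0 < R)
    (hR : R ≤ k / 24000) (hδ0 : 0 ≤ δ) (hδR : δ ≤ R)
    (hS : mixedNorm C w (fun i => sqrtHess φ x i * newtonStep P φ t x w i) ≤ cγ * δ)
    (hx' : x + newtonStep P φ t x w ∈ P.interior) (hv : ‖logError g x w‖ ≤ K) :
    mixedNorm C w (vecLog (g (x + newtonStep P φ t x w)) - vecLog (g x)) ≤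
      (1 - 7 / 8 * k) * δ := by
  have hs := hS.trans (mul_le_mul_of_nonneg_right hg.slack_le hδ0)
  have hk19 : 0 ≤ k / 19 := by linarith
  refine mixedNorm_log_weight_sub_le hφ hC hg hcδ hx hx' hw (r := 5 / 4 * δ) (κ := K)
    (β := R) (a := 1 + k / 19) (sqrtHess_mul_abs_le hC hs) (by linarith) hv (by linarith) ?_ ?_ ?_
  · refine (Real.exp_le_exp.2 (show K + R ≤ k / 19 by linarith)).trans ?_
    refine (exp_le_one_add_add_sq hk19 (by linarith)).trans ?_
    linarith
  · calc _ ≤ (1 + k / 19) ^ 2 * cδ * (cγ * δ) := mul_le_mul_of_nonneg_left hS (by positivity)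
      _ = (1 + k / 19) ^ 2 * (cδ * cγ) * δ := by ring
      _ ≤ ((1 - 5 / 4 * δ) * (1 - 7 / 8 * k)) * δ := by
          refine mul_le_mul_of_nonneg_right ?_ hδ0
          rw [hk]
          exact sensitivity_constant_le hk0.le hk1 hδ0 (hδR.trans hR)
      _ = (1 - 5 / 4 * δ) * ((1 - 7 / 8 * k) * δ) := by ring
  · exact (mul_le_mul_of_nonneg_left hδR (by linarith)).trans_lt
      (mul_lt_of_lt_one_left hR0 (by linarith))

/-- The combined effect of the Newton step and the weight update on the centrality. -/
theorem centrality_step_contract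
    (hφ : ∀ i, IsSelfConcordantBarrier (P.l i) (P.u i) (φ i)) (hC : 0 ≤ C)
    (hx : x ∈ P.interior) (hw : ∀ i, 0 < w i) {k δ : ℝ} (hk0 : 0 ≤ k) (hk1 : k ≤ 1 / 5)
    (hδ0 : 0 ≤ δ) (hδk : δ ≤ k / 24000)
    (hs : mixedNorm C w (fun i => sqrtHess φ x i * newtonStep P φ t x w i) ≤ 5 / 4 * δ)
    {d : Fin m → ℝ} (hd : mixedNorm C w d ≤ (1 - 7 / 8 * k) * δ) :
    centrality P φ C t (x + newtonStep P φ t x w)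
      (fun i => Real.exp (Real.log (w i) - (1 + k / 2) * d i)) ≤ (1 - 1 / 4 * k) * δ := by
  have hk2 : 0 ≤ 1 + k / 2 := by linarith
  have hdnorm : ‖(1 + k / 2) • d‖ ≤ 2 * δ := by
    rw [norm_smul, Real.norm_of_nonneg hk2]
    have h1 : ‖d‖ ≤ δ := (norm_le_mixedNorm hC w d).trans
      (hd.trans (mul_le_of_le_one_left hδ0 (by linarith)))
    exact mul_le_mul (by linarith) h1 (norm_nonneg d) (by norm_num)
  have h1 := centrality_step_le hφ hC hx hw hs (by linarith) hdnorm (by linarith)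
  rw [mixedNorm_smul hC (fun i => (hw i).le), abs_of_nonneg hk2] at h1
  have h3 : (1 + k / 2) * mixedNorm C w d ≤ (1 - 3 / 8 * k) * δ := by
    calc (1 + k / 2) * mixedNorm C w d ≤ (1 + k / 2) * ((1 - 7 / 8 * k) * δ) :=
          mul_le_mul_of_nonneg_left hd hk2
      _ = ((1 + k / 2) * (1 - 7 / 8 * k)) * δ := by ring
      _ ≤ (1 - 3 / 8 * k) * δ := mul_le_mul_of_nonneg_right (by nlinarith) hδ0
  refine h1.trans ?_
  calc _ ≤ (1 + 2 * δ) * (3 * (5 / 4 * δ) * (5 / 4 * δ) +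
          (1 + 2 * δ) * ((1 - 3 / 8 * k) * δ)) := by gcongr
    _ = ((1 + 2 * δ) * (75 / 16 * δ + (1 + 2 * δ) * (1 - 3 / 8 * k))) * δ := by ring
    _ ≤ (1 - 1 / 4 * k) * δ :=
        mul_le_mul_of_nonneg_right (centrality_constant_le hk0 hk1 hδ0 hδk) hδ0

end Step

/-- The potential bound for the mixed-norm ball as the set of moves. The ball contains the cube of
side `ρ / (78 m)`, and the resulting threshold of order `m²` is below `(400 m)²`. -/
theorem potential_step_le {C : ℝ} (hm : 1 ≤ (m : ℝ)) (hC0 : 0 ≤ C)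
    (hC : C ≤ 48 * (m : ℝ) ^ (1 / 4 : ℝ)) {w : Fin m → ℝ} (hw : ∀ i, 0 ≤ w i)
    (hw2 : ∀ i, w i ≤ 5 / 2) {μ ε R ρ : ℝ} (hμ : 0 < μ) (hε : 0 < ε) (hε1 : ε ≤ 1 / 10)
    (hμR : μ * R = ε / 12) (hρ : 0 ≤ ρ) (hρR : ρ ≤ R) {v u d z : Fin m → ℝ}
    (hu : mixedNorm C w u ≤ ρ) (hd : mixedNorm C w d ≤ ρ) (hz : ‖z - (v + u)‖ ≤ R)
    (hmin : IsMinOn (fun y => fderiv ℝ (potential μ) z y) {y | mixedNorm C w y ≤ ρ} d)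
    (hv : potential μ v ≤ (400 * (m : ℝ)) ^ 2) :
    potential μ (v + u + (1 + ε) • d) ≤ (400 * (m : ℝ)) ^ 2 := by
  refine (potential_le_max (τ := 78 * m) hμ hε hε1 hμR hρ hρR (by linarith)
    (fun y hy => (norm_le_mixedNorm hC0 w y).trans hy)
    (fun y hy y' hyy' => (mixedNorm_mono hC0 hw hyy').trans hy) ?_ hu hd hz hmin).trans
    (max_le hv ?_)
  · intro y hy
    refine (mixedNorm_le_card_mul_norm hm hC0 hC hw hw2 y).trans ?_
    rw [le_div_iff₀ (by linarith)] at hy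
    linarith
  · have h1 : (m : ℝ) ≤ m * m := le_mul_of_one_le_left (by linarith) hm
    linarith

end WeightedPath
end

open WeightedPath in
theorem mainTheorem6 {m n : ℕ} (P : WeightedPath.LinProg m n) (φ : Fin m → ℝ → ℝ)
    (hφ : ∀ i, WeightedPath.IsSelfConcordantBarrier (P.l i) (P.u i) (φ i))
    (C : ℝ) (g : (Fin m → ℝ) → (Fin m → ℝ)) (c₁ cγ cδ : ℝ)
    (hg : WeightedPath.IsWeightFunction P φ C g c₁ cγ cδ)
    (ck : ℝ) (hck : ck = 1 / (1 - cδ * cγ)) (hck_lower : 5 ≤ ck)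
    (hck_upper : ck ≤ 24 * (m : ℝ) ^ (1 / 4 : ℝ))
    (hC_lower : 1 ≤ C) (hC_upper : C ≤ 2 * ck)
    (K : ℝ) (hK_pos : 0 < K) (hK : K ≤ 1 / (20 * ck))
    (μ : ℝ) (hμ : μ = 2 * Real.log (400 * m) / K)
    (t : ℝ) (ht : 0 ≤ t) (x w : Fin m → ℝ) (hx : x ∈ P.interior) (hw : ∀ i, 0 < w i)
    (δ : ℝ) (hδ : δ = WeightedPath.centrality P φ C t x w)
    (hδ_le : δ ≤ K / (48 * ck * Real.log (400 * m)))
    (hpot : WeightedPath.potential μ (WeightedPath.logError g x w) ≤ (400 * (m : ℝ)) ^ 2)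
    (x' w' : Fin m → ℝ)
    (hstep : WeightedPath.CenteringInexact P φ C g ck t K x w x' w') :
    x' ∈ P.interior ∧ (∀ i, 0 < w' i) ∧
    WeightedPath.centrality P φ C t x' w' ≤ (1 - 1 / (4 * ck)) * δ ∧
    WeightedPath.potential μ (WeightedPath.logError g x' w') ≤ (400 * (m : ℝ)) ^ 2 ∧
    ‖WeightedPath.vecLog (g x') - WeightedPath.vecLog w'‖ ≤ K ∧
    ‖WeightedPath.vecLog (g x') - WeightedPath.vecLog w‖ ≤ K + δ := by
  have hC0 : 0 ≤ C := by linarith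
  have hw0 : ∀ i, 0 ≤ w i := fun i => (hw i).le
  -- for `m = 0` the upper bound on `ck` would be zero
  have hm : 1 ≤ (m : ℝ) := by
    rcases Nat.eq_zero_or_pos m with h | h
    · rw [h, Nat.cast_zero, Real.zero_rpow (by norm_num)] at hck_upper
      linarith
    · exact_mod_cast h
  have hL := five_le_log hm
  set L := Real.log (400 * m) with hLdef
  have hL0 : 0 < L := by linarith
  have hck0 : 0 < ck := by linarith
  -- all bounds are expressed through `k = 1 / ck ∈ (0, 1/5]`
  set k := 1 / ck with hk
  have hk0 : 0 < k := by positivity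
  have hk1 : k ≤ 1 / 5 := one_div_le_one_div_of_le (by norm_num) hck_lower
  have hkδγ : cδ * cγ = 1 - k := by rw [hk, hck, one_div_one_div]; ring
  have hcγ0 : 0 < cγ := by linarith [hg.one_le_slack]
  have hcδ0 : 0 ≤ cδ := by
    by_contra hneg
    nlinarith [mul_neg_of_neg_of_pos (not_le.1 hneg) hcγ0]
  have hKk : K ≤ k / 20 := hK.trans_eq (by rw [hk]; field_simp)
  obtain ⟨R, hR⟩ : ∃ R, R = K / (48 * ck * L) := ⟨_, rfl⟩
  obtain ⟨ε, hε⟩ : ∃ ε, ε = 1 / (2 * ck) := ⟨_, rfl⟩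
  have hεk : ε = k / 2 := by rw [hε, hk]; field_simp
  have hR0 : 0 < R := by rw [hR]; positivity
  have hRk : R ≤ k / 24000 := by
    rw [hR, div_le_iff₀ (by positivity)]
    have h1 : 25 ≤ ck * L := by nlinarith
    nlinarith
  have hμ0 : 0 < μ := by rw [hμ]; positivity
  have hμR : μ * R = ε / 12 := by rw [hμ, hR, hε]; field_simp; norm_num
  -- the parameter of the potential that the algorithm minimizes is `μ`
  have hμε : ε / (12 * R) = μ := by rw [hμ, hR, hε]; field_simp; norm_num
  have hlogB : Real.log ((400 * (m : ℝ)) ^ 2) / μ = K := by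
    rw [Real.log_pow, ← hLdef, hμ]; field_simp; norm_num
  have hB1 : 1 ≤ (400 * (m : ℝ)) ^ 2 := one_le_pow₀ (by linarith)
  -- the potential bound forces `w` to be close to `g x`
  have hv : ‖logError g x w‖ ≤ K := (norm_le_of_potential_le hμ0 hB1 hpot).trans_eq hlogB
  have hgw := weight_bounds (hg.pos x hx) hw (by linarith) hv
  have hw2 : ∀ i, w i ≤ 5 / 2 := fun i => by
    have h1 := (le_abs_self _).trans ((norm_le_pi_norm (g x) i).trans (hg.uniformity x hx))
    linarith [(hgw i).2]
  -- the Newton step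
  obtain ⟨hx', z, d, hz, hdU, hmin, hw'⟩ := hstep
  rw [← hR] at hδ_le
  rw [← hLdef, ← hR] at hz
  rw [← hLdef, ← hR, ← hε, hμε] at hmin
  rw [← hε] at hw'
  have hδ0 : 0 ≤ δ := hδ ▸ centrality_nonneg hC0 t
  have hδk : δ ≤ k / 24000 := hδ_le.trans hRk
  have hq := sqrtHess_pos hφ hx
  have hS := mixedNorm_newtonStep_le (t := t) hC0 hcγ0.le hq hw
    (hg.slack x hx w hgw)
  rw [← hδ] at hS
  set h := newtonStep P φ t x w with hh
  have hs : mixedNorm C w (fun i => sqrtHess φ x i * h i) ≤ 5 / 4 * δ :=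
    hS.trans (mul_le_mul_of_nonneg_right hg.slack_le hδ0)
  have hx'int : x + h ∈ P.interior :=
    add_newtonStep_mem_interior hφ hC0 hx hw (hs.trans_lt (by linarith))
  have h78 : 7 / (8 * ck) = 7 / 8 * k := by rw [hk]; field_simp
  have h14 : 1 / (4 * ck) = 1 / 4 * k := by rw [hk]; field_simp
  rw [h78, ← hδ] at hdU hmin
  rw [h14]
  set ρ := (1 - 7 / 8 * k) * δ with hρ
  have hρ0 : 0 ≤ ρ := mul_nonneg (by linarith) hδ0
  have hρδ : ρ ≤ δ := mul_le_of_le_one_left hδ0 (by linarith)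
  set u := vecLog (g (x + h)) - vecLog (g x) with hu
  have huU : mixedNorm C w u ≤ ρ :=
    mixedNorm_log_weight_newtonStep_le hφ hC0 hg hcδ0 hx hw hkδγ hk0 hk1 hKk hR0 hRk hδ0 hδ_le
      hS hx'int hv
  have hd : mixedNorm C w d ≤ ρ := hdU
  -- the potential
  have hdecomp : logError g (x + h) w' = logError g x w + u + (1 + ε) • d := by
    ext i
    simp only [hw', hu, logError, vecLog, Pi.add_apply, Pi.sub_apply, Pi.smul_apply, smul_eq_mul,
      Real.log_exp]
    ring
  have hpot' : potential μ (logError g (x + h) w') ≤ (400 * (m : ℝ)) ^ 2 := by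
    rw [hdecomp]
    refine potential_step_le hm hC0 (by linarith) hw0 hw2 hμ0 (by linarith) (by linarith) hμR
      hρ0 (hρδ.trans hδ_le) huU hd ?_ hmin hpot
    have h1 : z - vecLog w - (logError g x w + u) = z - vecLog (g x') := by
      rw [hu, logError, hx']; abel
    rw [h1]
    exact hz
  have hcent : centrality P φ C t (x + h) w' ≤ (1 - 1 / 4 * k) * δ := by
    rw [hw', hεk]
    exact centrality_step_contract hφ hC0 hx hw hk0.le hk1 hδ0 hδk hs hd
  subst hx'
  refine ⟨hx'int, fun i => hw' ▸ Real.exp_pos _, hcent, hpot',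
    (norm_le_of_potential_le hμ0 hB1 hpot').trans_eq hlogB, ?_⟩
  have h1 : vecLog (g (x + h)) - vecLog w = logError g x w + u := by
    rw [hu, logError]; abel
  rw [h1]
  exact (norm_add_le _ _).trans
    (add_le_add hv ((norm_le_mixedNorm hC0 w u).trans (huU.trans hρδ)))
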